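/- **Setting.** $K$ data sources generate $X_n=(X_n^1,\dots,X_n^K)$, $n=1,2,\dots$. For $s\subseteq[K]$ let $X^s=(X^k_n: k\in s,\,n\ge1)$, $\mathcal F^s_n=\sigma(X^s_1,\dots,X^s_n)$, $\mathcal F_n=\mathcal F_n^{[K]}$, and let $P^s$ be the marginal law of $X^s$ under a law $P$ of $X$; write $k$ for $\{k\}$ and omit $s=[K]$. Let $\mathcal P$ be a finite family of laws of $X$ and, for every $k\in[K]$, let $\mathcal H^k,\mathcal G^k\subseteq\{P^k:P\in\mathcal P\}$ be non-empty and disjoint (null and alternative for source $k$). Let $\mathcal A(P)=\{k: P^k\in\mathcal G^k\}$ (the signals) and let $\Psi$ be a family of subsets of $[K]$ with $\emptyset\in\Psi$. Put $$\mathcal P_\Psi=\{P\in\mathcal P: P^k\in\mathcal H^k\cup\mathcal G^k\ \forall k,\ \mathcal A(P)\in\Psi\},\qquad \mathcal H_0=\{P\in\mathcal P_\Psi:\mathcal A(P)=\emptyset\},$$ $$\mathcal H_{\Psi,k}=\{P\in\mathcal P_\Psi\setminus\mathcal H_0: k\notin\mathcal A(P)\},\qquad \mathcal G_{\Psi,k}=\{P\in\mathcal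 P_\Psi: k\in\mathcal A(P)\},$$ and assume that $\mathcal H_0$ and all $\mathcal H_{\Psi,k},\mathcal G_{\Psi,k}$ are non-empty. Let $\Psi_{0,u}=\{A\subseteq[K]: |A|\le u\}$. For laws $\mu,\nu$ of $X^s$ that are mutually absolutely continuous on every $\mathcal F^s_n$, let $\Lambda_n(\mu,\nu)=\frac{d\mu}{d\nu}(\mathcal F_n^s)$ and $Z_n(\mu,\nu)=\log\Lambda_n(\mu,\nu)$. The information number $\mathcal I(\mu,\nu)$ is the (necessarily unique) $c>0$, if it exists, such that $\mu(\max_{1\le m\le n}Z_m(\mu,\nu)\ge n\rho)\to0$ for all $\rho>c$ and $\sum_{n\ge1}\mu(Z_n(\mu,\nu)<n\rho)<\infty$ for all $\rho<c$; $\mathcal I(\mu,\nu)$ is well defined if the mutual absolute continuity holds and such a $c$ exists. Put $\mathcal I(\mu,\mathcal Q)=\min_{\nu\in\mathcal Q}\mathcal I(\mu,\nu)$. Assume, for all $k$ and all $s\ni k$, that $P^s,Q^s$ are mutually absolutely continuous on every $\mathcal F_n^s$ for $P\in\mathcal G_{\Psi,k}\cup\mathcal H_0$, $Q\in\mathcal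 H_{\Psi,k}\cup\mathcal H_0$, and that $\mathcal I(P^s,Q^s)$ and $\mathcal I(Q^s,P^s)$ exist for $P\in\mathcal G_{\Psi,k}$, $Q\in\mathcal H_{\Psi,k}\cup\mathcal H_0$. **Tests.** A test is a pair $(T,D)$ with $T\in\{1,2,\dots\}\cup\{\infty\}$, $\{T=n\}\in\mathcal F_n$, and $D$, the set of sources declared signals upon stopping, $\Psi$-valued with $\{T=n,D=A\}\in\mathcal F_n$ for all $n\ge 1$, $A\in\Psi$. For $\alpha,\beta,\gamma,\delta\in(0,1)$, $\mathcal C_\Psi(\alpha,\beta,\gamma,\delta)$ is the class of tests with $P(D\ne\emptyset)\le\alpha$ for $P\in\mathcal H_0$ and, for $P\in\mathcal P_\Psi\setminus\mathcal H_0$, $P(D=\emptyset)\le\beta$, $P(D\setminus\mathcal A(P)\ne\emptyset)\le\gamma$ and $P(\mathcal A(P)\setminus D\ne\emptyset,\,D\ne\emptyset)\le\delta$ (all events refer to the decision made upon stopping, i.e. on $\{T<\infty\}$). **The test $\chi^*=(T^*,D^*)$.** For every $k$ let $s_k\ni k$ be a subset of $[K]$ and let $s'_k=\{k\}$. With arbitrary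 reference laws $P_0,P_0'\in\mathcal H_0$ (they may depend on $k$), let $$\Lambda_{k,\rm det}(n)=\frac{\max_{P\in\mathcal G_{\Psi,k}}\Lambda_n(P^{s_k},P_0^{s_k})}{\max_{P\in\mathcal H_0}\Lambda_n(P^{s_k},P_0^{s_k})},\qquad \Lambda_{k,\rm iso}(n)=\frac{\max_{P\in\mathcal G_{\Psi,k}}\Lambda_n(P^{s'_k},P_0'^{s'_k})}{\max_{P\in\mathcal H_{\Psi,k}}\Lambda_n(P^{s'_k},P_0'^{s'_k})},$$ and $D_{\rm iso}(n)=\{k:\Lambda_{k,\rm iso}(n)>1\}$. For positive thresholds $A_k,B_k,C_k,D_k$, let $T_0=\inf\{n\ge1:\Lambda_{k,\rm det}(n)\le1/C_k\ \forall k\}$, let $T_{\rm joint}$ be the first $n\ge1$ with $\Lambda_{k,\rm det}(n)\ge D_k$ for some $k$, $\Lambda_{k,\rm iso}(n)\notin(1/A_k,B_k)$ for all $k$, and $D_{\rm iso}(n)\in\Psi\setminus\{\emptyset\}$; let $T^*=\min\{T_0,T_{\rm joint}\}$, with $D^*=\emptyset$ if $T_0<T_{\rm joint}$ and $D^*=D_{\rm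 iso}(T^*)$ otherwise. The thresholds are functions of $(\alpha,\beta,\gamma,\delta)\in(0,1)^4$ such that $\chi^*\in\mathcal C_\Psi(\alpha,\beta,\gamma,\delta)$ always, and $\log A_k\sim|\log\delta|$, $\log B_k\sim|\log\gamma|$, $\log C_k\sim|\log\beta|$, $\log D_k\sim|\log\alpha|$ for all $k$ as $\alpha,\beta,\gamma,\delta\to0$. Let $${\sf ARE}_P[\chi^*]=\limsup\ \frac{{\sf E}_P[T^*]}{\inf\{{\sf E}_P[T]:(T,D)\in\mathcal C_\Psi(\alpha,\beta,\gamma,\delta)\}},$$ the limsup being taken along any mode of convergence $\alpha,\beta,\gamma,\delta\to0$ that satisfies the stated relation between the rates. **Theorem.** Let $P\in\mathcal P_\Psi\setminus\mathcal H_0$. (i) Let $\alpha,\beta,\gamma,\delta\to0$ with $(|\log\alpha|\vee|\log\delta|)/|\log\gamma|\to0$, and let $\mathcal I(P^k,\nu)$ be well defined for all $k\in\mathcal A(P)$, $\nu\in\mathcal H^k$. Then $${\sf ARE}_P[\chi^*]\le\frac{\min_{k\in\mathcal A(P)}\mathcal I(P,\mathcal H_{\Psi,k})}{\min_{k\in\mathcal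 A(P)}\mathcal I(P^k,\mathcal H^k)}.$$ If, also, $\Psi=\Psi_{0,u}$ for some $u$, $|\mathcal A(P)|>1$, and some source $k\in\mathcal A(P)$ that is independent of the other sources under $P$ achieves $\min_{j\in\mathcal A(P)}\mathcal I(P^j,\mathcal H^j)$, where $\mathcal I(P^k,\mathcal H^k)$ is attained at some $\nu\in\mathcal H^k$ with $\nu\otimes P^{[K]\setminus\{k\}}\in\mathcal P$, then ${\sf ARE}_P[\chi^*]=1$. (ii) Let $\alpha,\beta,\gamma,\delta\to0$ with $(|\log\alpha|\vee|\log\gamma|)/|\log\delta|\to0$, let $\mathcal A(P)\ne[K]$, and let $\mathcal I(P^k,\nu)$ be well defined for all $k\notin\mathcal A(P)$, $\nu\in\mathcal G^k$. Then $${\sf ARE}_P[\chi^*]\le\frac{\min_{k\notin\mathcal A(P)}\mathcal I(P,\mathcal G_{\Psi,k})}{\min_{k\notin\mathcal A(P)}\mathcal I(P^k,\mathcal G^k)}.$$ If, also, $\Psi=\Psi_{0,u}$ for some $u$, $|\mathcal A(P)|<u$, and some source $k\notin\mathcal A(P)$ that is independent of the other sources under $P$ achieves $\min_{j\notin\mathcal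 A(P)}\mathcal I(P^j,\mathcal G^j)$, where $\mathcal I(P^k,\mathcal G^k)$ is attained at some $\nu\in\mathcal G^k$ with $\nu\otimes P^{[K]\setminus\{k\}}\in\mathcal P$, then ${\sf ARE}_P[\chi^*]=1$. -/

import Mathlib

open MeasureTheory ProbabilityTheory Filter Topology Asymptotics

noncomputable section

namespace SeqMulti

/-! ### Laws of random sequences, likelihood ratios, information numbers

A sequence `x : ℕ → F` stands for the observations `X_1, X_2, …`, with `x i = X_{i+1}`; the first
`n` observations are `x 0, …, x (n-1)`. -/

section Sequences

variable {F : Type*} [MeasurableSpace F]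

/-- The first `n` observations of a sequence. -/
def prefixMap (n : ℕ) (x : ℕ → F) : Fin n → F := fun i => x i

/-- The law of the first `n` observations: the restriction of `μ` to the σ-field that they
generate. -/
def prefixLaw (n : ℕ) (μ : Measure (ℕ → F)) : Measure (Fin n → F) := μ.map (prefixMap n)

/-- The likelihood ratio `Λ_n(μ, ν)` of the first `n` observations. -/
def lik (n : ℕ) (μ ν : Measure (ℕ → F)) (x : ℕ → F) : ℝ :=
  ((prefixLaw n μ).rnDeriv (prefixLaw n ν) (prefixMap n x)).toReal

/-- The log-likelihood ratio `Z_n(μ, ν)`. -/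
def logLik (n : ℕ) (μ ν : Measure (ℕ → F)) (x : ℕ → F) : ℝ := Real.log (lik n μ ν x)

/-- Mutual absolute continuity on the observations up to each finite time. -/
def LocallyEquivalent (μ ν : Measure (ℕ → F)) : Prop :=
  ∀ n : ℕ, prefixLaw n μ ≪ prefixLaw n ν ∧ prefixLaw n ν ≪ prefixLaw n μ

/-- `c` is the information number `I(μ, ν)`: it is positive,
`μ(max_{1 ≤ m ≤ n} Z_m(μ, ν) ≥ n ρ) → 0` for every `ρ > c`, and
`∑_{n ≥ 1} μ(Z_n(μ, ν) < n ρ) < ∞` for every `ρ < c`. -/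
def IsInfo (μ ν : Measure (ℕ → F)) (c : ℝ) : Prop :=
  0 < c ∧
  (∀ ρ : ℝ, c < ρ →
    Tendsto (fun n : ℕ => μ {x | ∃ m : ℕ, 1 ≤ m ∧ m ≤ n ∧ (n : ℝ) * ρ ≤ logLik m μ ν x})
      atTop (𝓝 0)) ∧
  (∀ ρ : ℝ, ρ < c →
    ∑' n : ℕ, μ {x | logLik (n + 1) μ ν x < ((n + 1 : ℕ) : ℝ) * ρ} ≠ ⊤)

lemma isInfo_le {μ ν : Measure (ℕ → F)} [IsProbabilityMeasure μ] {c d : ℝ}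
    (hc : IsInfo μ ν c) (hd : IsInfo μ ν d) : d ≤ c := by
  by_contra hlt
  push Not at hlt
  obtain ⟨ρ, h1, h2⟩ := exists_between hlt
  have ha := (hc.2.1 ρ h1).comp (tendsto_add_atTop_nat 1)
  have hb := ENNReal.tendsto_atTop_zero_of_tsum_ne_top (hd.2.2 ρ h2)
  have hs := ha.add hb
  rw [add_zero] at hs
  have hone : ∀ n : ℕ, (1 : ENNReal) ≤
      ((fun n : ℕ => μ {x | ∃ m : ℕ, 1 ≤ m ∧ m ≤ n ∧ (n : ℝ) * ρ ≤ logLik m μ ν x}) ∘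
        (fun a => a + 1)) n
      + μ {x | logLik (n + 1) μ ν x < ((n + 1 : ℕ) : ℝ) * ρ} := by
    intro n
    refine le_trans ?_ (measure_union_le _ _)
    rw [← measure_univ (μ := μ)]
    apply measure_mono
    intro x _
    by_cases hx : logLik (n + 1) μ ν x < ((n + 1 : ℕ) : ℝ) * ρ
    · exact Or.inr hx
    · exact Or.inl ⟨n + 1, by omega, le_refl _, not_lt.mp hx⟩
  have := ge_of_tendsto' hs hone
  simp at this

/-- There is at most one information number. -/
lemma isInfo_unique {μ ν : Measure (ℕ → F)} [IsProbabilityMeasure μ] {c d : ℝ}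
    (hc : IsInfo μ ν c) (hd : IsInfo μ ν d) : c = d :=
  le_antisymm (isInfo_le hd hc) (isInfo_le hc hd)

open Classical in
/-- The information number `I(μ, ν)` (the value `0` is used when there is none). -/
def info (μ ν : Measure (ℕ → F)) : ℝ :=
  if h : ∃ c, IsInfo μ ν c then h.choose else 0

/-- `I(μ, ν)` is well defined. -/
def InfoDefined (μ ν : Measure (ℕ → F)) : Prop :=
  LocallyEquivalent μ ν ∧ ∃ c, IsInfo μ ν c

/-- `I(μ, 𝓠) = min_{ν ∈ 𝓠} I(μ, ν)`. -/
def infoSet (μ : Measure (ℕ → F)) (Q : Set (Measure (ℕ → F))) : ℝ := sInf (info μ '' Q)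

end Sequences

/-! ### Sources, global distributions, local hypotheses -/

/-- Realizations of `X^s`, the observations of the sources in `s` over time. -/
abbrev Traj {K : ℕ} (E : Fin K → Type*) (s : Finset (Fin K)) := ℕ → ∀ i : s, E i

/-- Realizations of `X`, the observations of all the sources over time. -/
abbrev Path {K : ℕ} (E : Fin K → Type*) := ℕ → ∀ i, E i

section Model

variable {K : ℕ} {E : Fin K → Type*} [∀ i, MeasurableSpace (E i)]

/-- `X^s` as a function of `X`. -/
def restr (s : Finset (Fin K)) (ω : Path E) : Traj E s := fun n i => ω n i

/-- The marginal distribution `P^s` of `X^s` under `P`. -/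
def marg (s : Finset (Fin K)) (P : Measure (Path E)) : Measure (Traj E s) := P.map (restr s)

/-- Source `k` is independent of the other sources under `P`. -/
def IndepOfRest (P : Measure (Path E)) (k : Fin K) : Prop :=
  IndepFun (restr (E := E) {k}) (restr (E := E) ({k}ᶜ : Finset (Fin K))) P

/-- `Q` is the product of `ν` on source `k` and of the marginal of `P` on the other sources. -/
def IsSwap (P : Measure (Path E)) (k : Fin K) (ν : Measure (Traj E {k}))
    (Q : Measure (Path E)) : Prop :=
  IndepOfRest Q k ∧ marg {k} Q = ν ∧
    marg ({k}ᶜ : Finset (Fin K)) Q = marg ({k}ᶜ : Finset (Fin K)) P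

/-- The σ-field `𝓕_n` of the observations of all the sources up to time `n`. -/
@[reducible] def sigmaUpTo (E : Fin K → Type*) [∀ i, MeasurableSpace (E i)] (n : ℕ) :
    MeasurableSpace (Path E) :=
  MeasurableSpace.comap (prefixMap n) inferInstance

variable (E) in
/-- The multiple testing problem whose units are the individual sources: the finite family of
plausible global distributions, the null and the alternative for the marginal distribution of each
source, and the prior information `Ψ` on the set of signals. A unit `{k}` is written `k`. -/
structure Problem where
  plaus : Set (Measure (Path E))
  null : ∀ k : Fin K, Set (Measure (Traj E {k}))
  alt : ∀ k : Fin K, Set (Measure (Traj E {k}))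
  Ψ : Set (Finset (Fin K))
  plaus_finite : plaus.Finite
  plaus_prob : ∀ P ∈ plaus, IsProbabilityMeasure P
  null_subset : ∀ k, null k ⊆ marg {k} '' plaus
  alt_subset : ∀ k, alt k ⊆ marg {k} '' plaus
  null_nonempty : ∀ k, (null k).Nonempty
  alt_nonempty : ∀ k, (alt k).Nonempty
  disjoint : ∀ k, Disjoint (null k) (alt k)

/-- The family `Ψ_{l,u}` of the sets of at least `l` and at most `u` sources. -/
def psiBetween (K l u : ℕ) : Set (Finset (Fin K)) := {A | l ≤ A.card ∧ A.card ≤ u}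

/-- The four error levels. -/
structure Levels where
  α : ℝ
  β : ℝ
  γ : ℝ
  δ : ℝ

/-- All four levels lie in `(0, 1)`. -/
def Levels.InUnit (v : Levels) : Prop :=
  v.α ∈ Set.Ioo (0 : ℝ) 1 ∧ v.β ∈ Set.Ioo (0 : ℝ) 1 ∧
    v.γ ∈ Set.Ioo (0 : ℝ) 1 ∧ v.δ ∈ Set.Ioo (0 : ℝ) 1

/-- The filter of `α, β, γ, δ → 0` through positive values. -/
def Levels.toZero : Filter Levels :=
  comap Levels.α (𝓝[>] 0) ⊓ comap Levels.β (𝓝[>] 0) ⊓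
    comap Levels.γ (𝓝[>] 0) ⊓ comap Levels.δ (𝓝[>] 0)

/-- The thresholds `A_k, B_k, C_k, D_k`, as functions of the error levels. -/
structure Thresholds (K : ℕ) where
  A : Fin K → Levels → ℝ
  B : Fin K → Levels → ℝ
  C : Fin K → Levels → ℝ
  D : Fin K → Levels → ℝ

namespace Problem

variable (M : Problem E)

open Classical in
/-- The set of signals `𝓐(P)`. -/
def signals (P : Measure (Path E)) : Finset (Fin K) :=
  Finset.univ.filter fun k => marg {k} P ∈ M.alt k

/-- `𝓟_Ψ`. -/
def compat : Set (Measure (Path E)) :=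
  {P | P ∈ M.plaus ∧ (∀ k, marg {k} P ∈ M.null k ∪ M.alt k) ∧ M.signals P ∈ M.Ψ}

/-- `𝓗_0`, the global null distributions. -/
def globalNull : Set (Measure (Path E)) :=
  {P | P ∈ M.plaus ∧ (∀ k, marg {k} P ∈ M.null k ∪ M.alt k) ∧ M.signals P = ∅}

/-- `𝓗_{Ψ,k}`. -/
def nullAt (k : Fin K) : Set (Measure (Path E)) :=
  {P | P ∈ M.compat \ M.globalNull ∧ k ∉ M.signals P}

/-- `𝓖_{Ψ,k}`. -/
def altAt (k : Fin K) : Set (Measure (Path E)) := {P | P ∈ M.compat ∧ k ∈ M.signals P}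

/-- `I(P, 𝓠; s) = min_{Q ∈ 𝓠} I(P^s, Q^s)`. -/
def infoOn (s : Finset (Fin K)) (P : Measure (Path E)) (Q : Set (Measure (Path E))) : ℝ :=
  infoSet (marg s P) (marg s '' Q)

/-- The mutual absolute continuity assumption on the plausible distributions. -/
def AbsContAssumption : Prop :=
  ∀ k : Fin K, ∀ P ∈ M.altAt k ∪ M.globalNull, ∀ Q ∈ M.nullAt k ∪ M.globalNull,
    ∀ s : Finset (Fin K), k ∈ s → LocallyEquivalent (marg s P) (marg s Q)

/-- The assumption that the information numbers between alternatives and nulls exist. -/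
def InfoAssumption : Prop :=
  ∀ k : Fin K, ∀ P ∈ M.altAt k, ∀ Q ∈ M.nullAt k ∪ M.globalNull,
    ∀ s : Finset (Fin K), k ∈ s →
      (∃ c, IsInfo (marg s P) (marg s Q) c) ∧ (∃ c, IsInfo (marg s Q) (marg s P) c)

/-! ### Tests -/

/-- `(T, D)` is a test: `T` takes values in `{1, 2, …} ∪ {∞}`, `{T = n} ∈ 𝓕_n`, and `D`, the
decision upon stopping, is `Ψ`-valued with `{T = n, D = A} ∈ 𝓕_n`. -/
def IsTest (T : Path E → ℕ∞) (D : Path E → Finset (Fin K)) : Prop :=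
  (∀ ω, 1 ≤ T ω) ∧ (∀ ω, T ω ≠ ⊤ → D ω ∈ M.Ψ) ∧
  (∀ n : ℕ, 1 ≤ n → MeasurableSet[sigmaUpTo E n] {ω | T ω = n}) ∧
  (∀ n : ℕ, 1 ≤ n → ∀ A ∈ M.Ψ, MeasurableSet[sigmaUpTo E n] {ω | T ω = n ∧ D ω = A})

/-- The class `𝓒_Ψ(α, β, γ, δ)` of the tests that control the probabilities of a false alarm, a
missed detection, a false positive and a false negative. -/
def InClass (v : Levels) (T : Path E → ℕ∞) (D : Path E → Finset (Fin K)) : Prop :=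
  M.IsTest T D ∧
  (∀ P ∈ M.globalNull, P {ω | T ω ≠ ⊤ ∧ D ω ≠ ∅} ≤ ENNReal.ofReal v.α) ∧
  (∀ P ∈ M.compat \ M.globalNull,
    P {ω | T ω ≠ ⊤ ∧ D ω = ∅} ≤ ENNReal.ofReal v.β ∧
    P {ω | T ω ≠ ⊤ ∧ D ω \ M.signals P ≠ ∅} ≤ ENNReal.ofReal v.γ ∧
    P {ω | T ω ≠ ⊤ ∧ M.signals P \ D ω ≠ ∅ ∧ D ω ≠ ∅} ≤ ENNReal.ofReal v.δ)

/-- The expected sample size `E_P[T]`. -/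
def expect (P : Measure (Path E)) (T : Path E → ℕ∞) : ENNReal :=
  ∫⁻ ω, (T ω : ENNReal) ∂P

/-- `inf {E_P[T] : (T, D) ∈ 𝓒_Ψ(α, β, γ, δ)}`. -/
def optimal (P : Measure (Path E)) (v : Levels) : ENNReal :=
  sInf {t | ∃ T D, M.InClass v T D ∧ t = expect P T}

/-! ### The proposed test -/

/-- The maximum over `Q ∈ 𝓠` of the likelihood ratio `Λ_n(Q^s, R^s)`. -/
def maxLik (s : Finset (Fin K)) (Q : Set (Measure (Path E))) (R : Measure (Path E)) (n : ℕ)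
    (ω : Path E) : ℝ :=
  sSup ((fun P => lik n (marg s P) (marg s R) (restr s ω)) '' Q)

/-- The detection statistic of source `k` with detection subsystem `s` and reference measure `R`. -/
def detStat (s : Finset (Fin K)) (R : Measure (Path E)) (k : Fin K) (n : ℕ) (ω : Path E) : ℝ :=
  maxLik s (M.altAt k) R n ω / maxLik s M.globalNull R n ω

/-- The isolation statistic of source `k` with isolation subsystem `s` and reference measure
`R`. -/
def isoStat (s : Finset (Fin K)) (R : Measure (Path E)) (k : Fin K) (n : ℕ) (ω : Path E) : ℝ :=
  maxLik s (M.altAt k) R n ω / maxLik s (M.nullAt k) R n ω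

/-- The choices that enter the test: the detection and the isolation subsystem of each source, the
reference measures in the two statistics of each source, and the thresholds. -/
structure Design (E : Fin K → Type*) [∀ i, MeasurableSpace (E i)] where
  detSub : Fin K → Finset (Fin K)
  isoSub : Fin K → Finset (Fin K)
  detRef : Fin K → Measure (Path E)
  isoRef : Fin K → Measure (Path E)
  thr : Thresholds K

variable (d : Design E)

open Classical in
/-- `D_iso(n)`: the sources whose isolation statistic exceeds `1` at time `n`. -/
def isoSet (n : ℕ) (ω : Path E) : Finset (Fin K) :=
  Finset.univ.filter fun k => 1 < M.isoStat (d.isoSub k) (d.isoRef k) k n ω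

/-- The stopping time `T_0`. -/
def stopNull (v : Levels) (ω : Path E) : ℕ∞ :=
  sInf {t | ∃ n : ℕ, t = n ∧ 1 ≤ n ∧
    ∀ k, M.detStat (d.detSub k) (d.detRef k) k n ω ≤ 1 / d.thr.C k v}

/-- The stopping time `T_joint`. -/
def stopJoint (v : Levels) (ω : Path E) : ℕ∞ :=
  sInf {t | ∃ n : ℕ, t = n ∧ 1 ≤ n ∧
    (∃ k, d.thr.D k v ≤ M.detStat (d.detSub k) (d.detRef k) k n ω) ∧
    (∀ k, M.isoStat (d.isoSub k) (d.isoRef k) k n ω ∉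
      Set.Ioo (1 / d.thr.A k v) (d.thr.B k v)) ∧
    M.isoSet d n ω ∈ M.Ψ \ {∅}}

/-- `T^*`. -/
def stopStar (v : Levels) (ω : Path E) : ℕ∞ := min (M.stopNull d v ω) (M.stopJoint d v ω)

open Classical in
/-- `D^*`. -/
def decStar (v : Levels) (ω : Path E) : Finset (Fin K) :=
  if M.stopNull d v ω < M.stopJoint d v ω then ∅ else M.isoSet d (M.stopStar d v ω).toNat ω

/-- The subsystems contain their source, the reference measures are global nulls, the thresholds
are positive and chosen so that `χ^* ∈ 𝓒_Ψ(α, β, γ, δ)` for all levels, with `log A_k ∼ |log δ|`,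
`log B_k ∼ |log γ|`, `log C_k ∼ |log β|`, `log D_k ∼ |log α|` as the levels go to `0`. -/
structure Admissible : Prop where
  mem_detSub : ∀ k, k ∈ d.detSub k
  mem_isoSub : ∀ k, k ∈ d.isoSub k
  detRef_mem : ∀ k, d.detRef k ∈ M.globalNull
  isoRef_mem : ∀ k, d.isoRef k ∈ M.globalNull
  pos : ∀ k v, v.InUnit →
    0 < d.thr.A k v ∧ 0 < d.thr.B k v ∧ 0 < d.thr.C k v ∧ 0 < d.thr.D k v
  inClass : ∀ v : Levels, v.InUnit → M.InClass v (M.stopStar d v) (M.decStar d v)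
  log_A : ∀ k, (fun v => Real.log (d.thr.A k v)) ~[Levels.toZero] fun v => |Real.log v.δ|
  log_B : ∀ k, (fun v => Real.log (d.thr.B k v)) ~[Levels.toZero] fun v => |Real.log v.γ|
  log_C : ∀ k, (fun v => Real.log (d.thr.C k v)) ~[Levels.toZero] fun v => |Real.log v.β|
  log_D : ∀ k, (fun v => Real.log (d.thr.D k v)) ~[Levels.toZero] fun v => |Real.log v.α|

/-- The asymptotic relative efficiency of `χ^*` under `P` as the levels go to `0` along `l`. -/
def ARE (P : Measure (Path E)) (l : Filter Levels) : ENNReal :=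
  limsup (fun v => expect P (M.stopStar d v) / M.optimal P v) l

/-- `min_{k ∈ S} I(P^k, 𝓠^k)` for families `𝓠^k` of distributions of `X^k`. -/
def minLocalInfo (S : Finset (Fin K)) (P : Measure (Path E))
    (Q : ∀ k : Fin K, Set (Measure (Traj E {k}))) : ℝ :=
  sInf ((fun k => infoSet (marg {k} P) (Q k)) '' (S : Set (Fin K)))

/-- `min_{k ∈ S} I(P, 𝓠_k)` for families `𝓠_k` of distributions of `X`. -/
def minGlobalInfo (S : Finset (Fin K)) (P : Measure (Path E))
    (Q : Fin K → Set (Measure (Path E))) : ℝ :=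
  sInf ((fun k => infoOn Finset.univ P (Q k)) '' (S : Set (Fin K)))

/-- Source `k ∈ S` is independent of the others under `P` and achieves
`min_{j ∈ S} I(P^j, 𝓠^j)`; moreover `I(P^k, 𝓠^k)` is attained at some `ν ∈ 𝓠^k` for which the
product of `ν` and of the marginal of `P` on the other sources is a plausible distribution. -/
def IndepHardest (S : Finset (Fin K)) (P : Measure (Path E))
    (Q : ∀ k : Fin K, Set (Measure (Traj E {k}))) (k : Fin K) : Prop :=
  k ∈ S ∧ IndepOfRest P k ∧ infoSet (marg {k} P) (Q k) = minLocalInfo S P Q ∧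
    ∃ ν ∈ Q k, info (marg {k} P) ν = infoSet (marg {k} P) (Q k) ∧
      ∃ R ∈ M.plaus, IsSwap P k ν R

end Problem

end Model

end SeqMulti

end

open SeqMulti

/-! Both parts compare two bounds on the common scale $L$, which is $|\log\gamma|$ in (i) and
$|\log\delta|$ in (ii).

Lower bound, for every test of the class: if $Q$ differs from $P$ in the status of source $k$, a
decision that is right for $P$ on $k$ is an error under $Q$, of probability at most $e^{-L}$. Before
time $L/\rho$ with $\rho>\mathcal I(P,Q)$, the log-likelihood ratio of $P$ against $Q$ is too small
for that decision to be likely under $P$ (`prob_stop_le`). Hence the optimal expected sample size is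
eventually at least $L/\rho$ (`eventually_le_optimal`).

Upper bound, for $\chi^*$: once all relevant log-likelihood ratios grow at their proper rates, every
isolation statistic lies on its correct side, $D_{\rm iso}=\mathcal A(P)\in\Psi$, and one detection
statistic has crossed (`stopStar_le`). The times at which some ratio lags have summable
probabilities, so they add only a constant to the expectation (`lintegral_enat_le`,
`exists_expect_stopStar_le`). Thresholds of smaller order than $L$ cost nothing in the limit; the
dominant ones cost $L$ divided by the least local information, since isolation uses only source $k$.

The quotient of the two rates bounds the ARE (`ARE_le`). When the hardest source is independent of
the rest, replacing its marginal by $\nu$ gives a competitor whose likelihood ratio on all the data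
is that of source $k$ alone (`isLogLik_swap`). The two rates then agree, and the ARE is $1$ because
$\chi^*$ is itself in the class (`one_le_ARE`). -/

namespace SeqMulti

/-! ### Calculus of likelihood ratios at a fixed time. -/

section Likelihood

variable {F : Type*} [MeasurableSpace F]

lemma measurable_prefixMap (n : ℕ) : Measurable (prefixMap (F := F) n) :=
  measurable_pi_lambda _ fun i => measurable_pi_apply (i : ℕ)

instance (n : ℕ) (μ : Measure (ℕ → F)) [IsProbabilityMeasure μ] :
    IsProbabilityMeasure (prefixLaw n μ) :=
  Measure.isProbabilityMeasure_map (measurable_prefixMap n).aemeasurable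

lemma LocallyEquivalent.symm {μ ν : Measure (ℕ → F)} (h : LocallyEquivalent μ ν) :
    LocallyEquivalent ν μ := fun n => ⟨(h n).2, (h n).1⟩

lemma LocallyEquivalent.trans {μ ν κ : Measure (ℕ → F)} (h : LocallyEquivalent μ ν)
    (h' : LocallyEquivalent ν κ) : LocallyEquivalent μ κ :=
  fun n => ⟨(h n).1.trans (h' n).1, (h' n).2.trans (h n).2⟩

lemma LocallyEquivalent.refl (μ : Measure (ℕ → F)) : LocallyEquivalent μ μ :=
  fun _ => ⟨Measure.AbsolutelyContinuous.rfl, Measure.AbsolutelyContinuous.rfl⟩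

lemma ae_of_ae_prefixLaw {n : ℕ} {μ : Measure (ℕ → F)} {p : (Fin n → F) → Prop}
    (h : ∀ᵐ y ∂prefixLaw n μ, p y) : ∀ᵐ x ∂μ, p (prefixMap n x) :=
  ae_of_ae_map (measurable_prefixMap n).aemeasurable h

/-- Positivity is needed under a third law: the statistics evaluate likelihoods of competitors under
the true law, and a vanishing denominator would give the default quotient $0$. -/
lemma ae_lik_pos {κ μ ν : Measure (ℕ → F)} [IsProbabilityMeasure μ] [IsProbabilityMeasure ν]
    (h : LocallyEquivalent κ μ) (h' : LocallyEquivalent μ ν) (n : ℕ) :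
    ∀ᵐ x ∂κ, 0 < lik n μ ν x := by
  refine ae_of_ae_prefixLaw (p := fun y =>
    0 < ((prefixLaw n μ).rnDeriv (prefixLaw n ν) y).toReal) ?_
  refine (h n).1.ae_le ?_
  filter_upwards [Measure.rnDeriv_pos (h' n).1,
    (h' n).1.ae_le (Measure.rnDeriv_lt_top (prefixLaw n μ) (prefixLaw n ν))] with y h1 h2
  exact ENNReal.toReal_pos h1.ne' h2.ne

/-- The chain rule for Radon–Nikodym derivatives; through it the arbitrary reference laws drop out
of the statistics. -/
lemma ae_lik_mul {κ μ ν ξ : Measure (ℕ → F)} [IsProbabilityMeasure μ] [IsProbabilityMeasure ν]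
    [IsProbabilityMeasure ξ] (h : LocallyEquivalent κ ξ) (h' : LocallyEquivalent μ ν) (n : ℕ) :
    ∀ᵐ x ∂κ, lik n μ ν x * lik n ν ξ x = lik n μ ξ x := by
  refine ae_of_ae_prefixLaw (p := fun y =>
    ((prefixLaw n μ).rnDeriv (prefixLaw n ν) y).toReal *
      ((prefixLaw n ν).rnDeriv (prefixLaw n ξ) y).toReal =
      ((prefixLaw n μ).rnDeriv (prefixLaw n ξ) y).toReal) ?_
  refine (h n).1.ae_le ?_
  filter_upwards [Measure.rnDeriv_mul_rnDeriv (κ := prefixLaw n ξ) (h' n).1] with y hy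
  rw [← ENNReal.toReal_mul, ← hy, Pi.mul_apply]

/-- If `Z_n(μ, ν) ≥ y`, then `e^y Λ_n(ν, ξ) ≤ Λ_n(μ, ξ)`. -/
lemma ae_exp_mul_lik_le {μ ν ξ : Measure (ℕ → F)} [IsProbabilityMeasure μ]
    [IsProbabilityMeasure ν] [IsProbabilityMeasure ξ] (h : LocallyEquivalent μ ξ)
    (h' : LocallyEquivalent μ ν) (n : ℕ) :
    ∀ᵐ x ∂μ, ∀ y, y ≤ logLik n μ ν x → Real.exp y * lik n ν ξ x ≤ lik n μ ξ x := by
  filter_upwards [ae_lik_mul h h' n, ae_lik_pos (LocallyEquivalent.refl μ) h' n]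
    with x h1 h2 y hy
  rw [← h1]
  refine mul_le_mul_of_nonneg_right ?_ ENNReal.toReal_nonneg
  rwa [← Real.le_log_iff_exp_le h2]

lemma isInfo_info {μ ν : Measure (ℕ → F)} (h : ∃ c, IsInfo μ ν c) : IsInfo μ ν (info μ ν) := by
  rw [info, dif_pos h]
  exact h.choose_spec

lemma withDensity_inter_log_lt_le {X : Type*} [MeasurableSpace X] (m : Measure X)
    {r : X → ENNReal} (hr : Measurable r) (hfin : ∀ᵐ y ∂m, r y < ⊤) {S : Set X}
    (hS : MeasurableSet S) (x : ℝ) :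
    (m.withDensity r) (S ∩ {y | Real.log (r y).toReal < x}) ≤
      ENNReal.ofReal (Real.exp x) * m S := by
  have hm : MeasurableSet (S ∩ {y | Real.log (r y).toReal < x}) :=
    hS.inter (measurableSet_lt (Real.measurable_log.comp hr.ennreal_toReal) measurable_const)
  rw [withDensity_apply _ hm]
  calc ∫⁻ y in S ∩ {y | Real.log (r y).toReal < x}, r y ∂m
      ≤ ∫⁻ _ in S ∩ {y | Real.log (r y).toReal < x}, ENNReal.ofReal (Real.exp x) ∂m := by
        refine lintegral_mono_ae ?_
        rw [ae_restrict_iff' hm]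
        filter_upwards [hfin] with y hy hmem
        -- Where the density vanishes its logarithm is $0$ by convention and says nothing about its
        -- size, but the bound is trivial there.
        rcases eq_or_ne (r y) 0 with h0 | h0
        · simp [h0]
        · have hpos : 0 < (r y).toReal := ENNReal.toReal_pos h0 hy.ne
          rw [← ENNReal.ofReal_toReal hy.ne]
          exact ENNReal.ofReal_le_ofReal ((Real.log_lt_iff_lt_exp hpos).1 hmem.2).le
    _ ≤ ENNReal.ofReal (Real.exp x) * m S := by
        rw [setLIntegral_const]
        gcongr
        exact Set.inter_subset_left

end Likelihood

/-! ### Change of measure on the observations up to a fixed time. -/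

section ChangeOfMeasure

variable {K : ℕ} {E : Fin K → Type*} [∀ i, MeasurableSpace (E i)]

/-- `Z` bounds the density of `P` with respect to `Q` on the events up to each time. -/
def IsLogLik (P Q : Measure (Path E)) (Z : ℕ → Path E → ℝ) : Prop :=
  ∀ (n : ℕ) (S : Set (Path E)), MeasurableSet[sigmaUpTo E n] S → ∀ x : ℝ,
    P (S ∩ {ω | Z n ω < x}) ≤ ENNReal.ofReal (Real.exp x) * Q S

lemma sigmaUpTo_le (n : ℕ) : sigmaUpTo E n ≤ (inferInstance : MeasurableSpace (Path E)) :=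
  (measurable_prefixMap n).comap_le

lemma measurable_restr (s : Finset (Fin K)) : Measurable (restr (E := E) s) :=
  measurable_pi_lambda _ fun n => measurable_pi_lambda _ fun i =>
    (measurable_pi_apply (i : Fin K)).comp (measurable_pi_apply n)

instance (s : Finset (Fin K)) (P : Measure (Path E)) [IsProbabilityMeasure P] :
    IsProbabilityMeasure (marg s P) :=
  Measure.isProbabilityMeasure_map (measurable_restr s).aemeasurable

/-- The map `q` recodes the path and `h` recovers the first $n$ observations from it, so an event of
$\mathcal F_n$ is a preimage under `q` and the density may be computed after recoding. -/
lemma measure_inter_log_lt_le_of_factor {X : Type*} [MeasurableSpace X] {n : ℕ}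
    {P Q : Measure (Path E)} {q : Path E → X} (hq : Measurable q)
    {h : X → Fin n → ∀ i, E i} (hh : Measurable h) (hhq : ∀ ω, h (q ω) = prefixMap n ω)
    {r : X → ENNReal} (hr : Measurable r) (hfin : ∀ᵐ y ∂(Q.map q), r y < ⊤)
    (hPQ : P.map q = (Q.map q).withDensity r) {S : Set (Path E)}
    (hS : MeasurableSet[sigmaUpTo E n] S) (x : ℝ) :
    P (S ∩ {ω | Real.log (r (q ω)).toReal < x}) ≤ ENNReal.ofReal (Real.exp x) * Q S := by
  obtain ⟨S', hS', rfl⟩ := hS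
  have hpre : prefixMap n ⁻¹' S' = q ⁻¹' (h ⁻¹' S') := by
    ext ω; simp [hhq]
  have key := withDensity_inter_log_lt_le (Q.map q) hr hfin (hh hS') x
  rw [← hPQ, Measure.map_apply hq (hh hS')] at key
  rw [hpre]
  exact (Measure.le_map_apply hq.aemeasurable _).trans key

lemma isLogLik_marg_univ {P Q : Measure (Path E)} [IsProbabilityMeasure P]
    [IsProbabilityMeasure Q]
    (h : LocallyEquivalent (marg Finset.univ P) (marg Finset.univ Q)) :
    IsLogLik P Q fun n ω =>
      logLik n (marg Finset.univ P) (marg Finset.univ Q) (restr Finset.univ ω) := by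
  intro n S hS x
  have hmap : ∀ R : Measure (Path E),
      R.map (fun ω => prefixMap n (restr Finset.univ ω)) = prefixLaw n (marg Finset.univ R) :=
    fun R => (Measure.map_map (measurable_prefixMap n) (measurable_restr _)).symm
  refine measure_inter_log_lt_le_of_factor (P := P) (Q := Q)
    (q := fun ω => prefixMap n (restr Finset.univ ω))
    ((measurable_prefixMap n).comp (measurable_restr _))
    (h := fun y t i => y t ⟨i, Finset.mem_univ i⟩) ?_ (fun ω => rfl)
    (r := (prefixLaw n (marg Finset.univ P)).rnDeriv (prefixLaw n (marg Finset.univ Q)))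
    (Measure.measurable_rnDeriv _ _) ?_ ?_ hS x
  · exact measurable_pi_lambda _ fun t => measurable_pi_lambda _ fun i =>
      (measurable_pi_apply _).comp (measurable_pi_apply t)
  · rw [hmap]; exact Measure.rnDeriv_lt_top _ _
  · rw [hmap, hmap, Measure.withDensity_rnDeriv_eq _ _ (h n).1]

lemma map_prefix_prod {P : Measure (Path E)} [IsProbabilityMeasure P] {k : Fin K}
    (h : IndepOfRest P k) (n : ℕ) :
    P.map (fun ω => (prefixMap n (restr (E := E) {k} ω),
      prefixMap n (restr (E := E) ({k}ᶜ : Finset (Fin K)) ω))) =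
    (prefixLaw n (marg {k} P)).prod (prefixLaw n (marg ({k}ᶜ : Finset (Fin K)) P)) := by
  have h' := IndepFun.comp h (measurable_prefixMap n) (measurable_prefixMap n)
  have := (indepFun_iff_map_prod_eq_prod_map_map
    ((measurable_prefixMap n).comp (measurable_restr _)).aemeasurable
    ((measurable_prefixMap n).comp (measurable_restr _)).aemeasurable).1 h'
  simp only [Function.comp_apply] at this
  rw [this, prefixLaw, prefixLaw, marg, marg,
    Measure.map_map (measurable_prefixMap n) (measurable_restr _),
    Measure.map_map (measurable_prefixMap n) (measurable_restr _)]

/-- Both laws are products with the same factor on the other sources, which cancels: the density on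
all the data is that of source $k$ alone. This is how a local information number enters the lower
bound. -/
lemma isLogLik_swap {P R : Measure (Path E)} [IsProbabilityMeasure P] [IsProbabilityMeasure R]
    {k : Fin K} {ν : Measure (Traj E {k})} (hP : IndepOfRest P k) (hR : IsSwap P k ν R)
    (h : LocallyEquivalent (marg {k} P) ν) :
    IsLogLik P R fun n ω => logLik n (marg {k} P) ν (restr {k} ω) := by
  intro n S hS x
  obtain ⟨hind, rfl, hrest⟩ := hR
  have hr : Measurable ((prefixLaw n (marg {k} P)).rnDeriv (prefixLaw n (marg {k} R))) :=
    Measure.measurable_rnDeriv _ _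
  refine measure_inter_log_lt_le_of_factor (P := P) (Q := R)
    (q := fun ω => (prefixMap n (restr (E := E) {k} ω),
      prefixMap n (restr (E := E) ({k}ᶜ : Finset (Fin K)) ω)))
    (((measurable_prefixMap n).comp (measurable_restr _)).prodMk
      ((measurable_prefixMap n).comp (measurable_restr _)))
    (h := fun y t i => if hi : i = k then y.1 t ⟨i, by simp [hi]⟩ else y.2 t ⟨i, by simp [hi]⟩)
    ?_ ?_
    (r := fun y => (prefixLaw n (marg {k} P)).rnDeriv (prefixLaw n (marg {k} R)) y.1)
    (hr.comp measurable_fst) ?_ ?_ hS x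
  · refine measurable_pi_lambda _ fun t => measurable_pi_lambda _ fun i => ?_
    by_cases hi : i = k
    · simp only [hi, dif_pos]
      exact (measurable_pi_apply _).comp ((measurable_pi_apply t).comp measurable_fst)
    · simp only [hi, dif_neg, not_false_iff]
      exact (measurable_pi_apply _).comp ((measurable_pi_apply t).comp measurable_snd)
  · intro ω
    funext t i
    by_cases hi : i = k <;> simp [hi, prefixMap, restr]
  · rw [map_prefix_prod hind]
    exact Measure.quasiMeasurePreserving_fst.ae (Measure.rnDeriv_lt_top _ _)
  · rw [map_prefix_prod hP, map_prefix_prod hind, hrest,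
      ← prod_withDensity_left hr, Measure.withDensity_rnDeriv_eq _ _ (h n).1]

end ChangeOfMeasure

end SeqMulti

namespace SeqMulti

/-! ### Information lower bound for arbitrary tests. -/

section LowerBound

variable {K : ℕ} {E : Fin K → Type*} [∀ i, MeasurableSpace (E i)] {M : Problem E}

/-- On $\{T=n\}$ the decision lies in the finite family $\Psi$, so any property of it splits into
finitely many events of $\mathcal F_n$. -/
lemma Problem.IsTest.measurableSet_eq_and {T : Path E → ℕ∞} {D : Path E → Finset (Fin K)}
    (h : M.IsTest T D) (g : Finset (Fin K) → Prop) {n : ℕ} (hn : 1 ≤ n) :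
    MeasurableSet[sigmaUpTo E n] {ω | T ω = n ∧ g (D ω)} := by
  have : {ω | T ω = n ∧ g (D ω)} = ⋃ B ∈ {B | B ∈ M.Ψ ∧ g B}, {ω | T ω = n ∧ D ω = B} := by
    ext ω
    simp only [Set.mem_ofPred_eq, Set.mem_iUnion, exists_prop]
    constructor
    · rintro ⟨h1, h2⟩
      exact ⟨D ω, ⟨h.2.1 ω (by rw [h1]; exact ENat.natCast_ne_top n), h2⟩, h1, rfl⟩
    · rintro ⟨B, ⟨_, hB⟩, h1, h2⟩
      exact ⟨h1, h2 ▸ hB⟩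
  rw [this]
  exact MeasurableSet.biUnion (Set.to_countable _) fun B hB => h.2.2.2 n hn B hB.1

lemma Problem.IsTest.measurableSet_le {T : Path E → ℕ∞} {D : Path E → Finset (Fin K)}
    (h : M.IsTest T D) (n : ℕ) : MeasurableSet {ω | T ω ≤ n} := by
  have : {ω | T ω ≤ n} = ⋃ m ∈ Finset.Icc 1 n, {ω | T ω = m} := by
    ext ω
    simp only [Set.mem_ofPred_eq, Set.mem_iUnion, Finset.mem_Icc, exists_prop]
    constructor
    · intro hle
      obtain ⟨m, hm⟩ := ENat.ne_top_iff_exists.1 (ne_top_of_le_ne_top (ENat.natCast_ne_top n) hle)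
      refine ⟨m, ⟨?_, ?_⟩, hm.symm⟩
      · have := h.1 ω; rw [← hm] at this; exact_mod_cast this
      · rw [← hm] at hle; exact_mod_cast hle
    · rintro ⟨m, ⟨_, hm⟩, h'⟩
      rw [h']; exact_mod_cast hm
  rw [this]
  exact Finset.measurableSet_biUnion _ fun m hm =>
    sigmaUpTo_le m _ (h.2.2.1 m (Finset.mem_Icc.1 hm).1)

/-- Wald's change of measure at the stopping time. -/
lemma prob_stop_le {T : Path E → ℕ∞} {D : Path E → Finset (Fin K)} (h : M.IsTest T D)
    {P Q : Measure (Path E)} {Z : ℕ → Path E → ℝ} (hZ : IsLogLik P Q Z)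
    (g : Finset (Fin K) → Prop) (n : ℕ) (x : ℝ) :
    P {ω | T ω ≤ n ∧ g (D ω)} ≤ P {ω | ∃ m : ℕ, 1 ≤ m ∧ m ≤ n ∧ x ≤ Z m ω} +
      ENNReal.ofReal (Real.exp x) * Q {ω | T ω ≠ ⊤ ∧ g (D ω)} := by
  set S : ℕ → Set (Path E) := fun m => {ω | T ω = m ∧ g (D ω)} with hS
  have hsub : {ω | T ω ≤ n ∧ g (D ω)} ⊆ {ω | ∃ m : ℕ, 1 ≤ m ∧ m ≤ n ∧ x ≤ Z m ω} ∪
      ⋃ m ∈ Finset.Icc 1 n, (S m ∩ {ω | Z m ω < x}) := by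
    rintro ω ⟨hle, hg⟩
    obtain ⟨m, hm⟩ := ENat.ne_top_iff_exists.1 (ne_top_of_le_ne_top (ENat.natCast_ne_top n) hle)
    have h1 : 1 ≤ m := by have := h.1 ω; rw [← hm] at this; exact_mod_cast this
    have h2 : m ≤ n := by rw [← hm] at hle; exact_mod_cast hle
    by_cases hx : x ≤ Z m ω
    · exact Or.inl ⟨m, h1, h2, hx⟩
    · refine Or.inr ?_
      simp only [Set.mem_iUnion, Finset.mem_Icc]
      exact ⟨m, ⟨h1, h2⟩, ⟨hm.symm, hg⟩, not_le.1 hx⟩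
  refine (measure_mono hsub).trans ((measure_union_le _ _).trans ?_)
  gcongr
  -- The events $\{T=m\}$ are disjoint, so the factor $e^x$ is paid once and not once per time.
  have hdisj : Set.PairwiseDisjoint (↑(Finset.Icc 1 n)) S := by
    intro a _ b _ hab
    refine Set.disjoint_left.2 fun ω ha hb => hab ?_
    exact_mod_cast ha.1.symm.trans hb.1
  calc P (⋃ m ∈ Finset.Icc 1 n, (S m ∩ {ω | Z m ω < x}))
      ≤ ∑ m ∈ Finset.Icc 1 n, P (S m ∩ {ω | Z m ω < x}) := measure_biUnion_finset_le _ _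
    _ ≤ ∑ m ∈ Finset.Icc 1 n, ENNReal.ofReal (Real.exp x) * Q (S m) :=
        Finset.sum_le_sum fun m hm =>
          hZ m (S m) (h.measurableSet_eq_and g (Finset.mem_Icc.1 hm).1) x
    _ = ENNReal.ofReal (Real.exp x) * Q (⋃ m ∈ Finset.Icc 1 n, S m) := by
        rw [← Finset.mul_sum, measure_biUnion_finset hdisj]
        exact fun m hm => sigmaUpTo_le m _ (h.measurableSet_eq_and g (Finset.mem_Icc.1 hm).1)
    _ ≤ _ := by
        gcongr
        intro ω hω
        simp only [Set.mem_iUnion] at hω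
        obtain ⟨m, _, hm, hg⟩ := hω
        exact ⟨by rw [hm]; exact ENat.natCast_ne_top m, hg⟩

/-- Markov's inequality on $\{T>n\}$, which includes $\{T=\infty\}$. -/
lemma mul_le_expect {T : Path E → ℕ∞} {D : Path E → Finset (Fin K)} (h : M.IsTest T D)
    (P : Measure (Path E)) [IsProbabilityMeasure P] (n : ℕ) :
    (n : ENNReal) * (1 - P {ω | T ω ≤ n}) ≤ Problem.expect P T := by
  have hm := (h.measurableSet_le n).compl
  rw [← prob_compl_eq_one_sub (h.measurableSet_le n), ← lintegral_indicator_const hm]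
  refine lintegral_mono fun ω => ?_
  rw [Set.indicator_apply]
  split_ifs with hω
  · have hω' : ¬ T ω ≤ n := hω
    rw [← ENat.toENNReal_coe]
    exact ENat.toENNReal_le.2 (not_le.1 hω').le
  · exact zero_le

lemma tendsto_abs_log {l : Filter Levels} {e : Levels → ℝ} (he : Tendsto e l (𝓝[>] 0)) :
    Tendsto (fun v => |Real.log (e v)|) l atTop :=
  tendsto_abs_atBot_atTop.comp (Real.tendsto_log_nhdsGT_zero.comp he)

/-- The information lower bound: if every test of the class decides `g` with probability at most
`e` under `Q` and `¬ g` with probability at most `r` under `P`, then its expected sample size under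
`P` is asymptotically at least `|log e| / c`. -/
lemma eventually_le_optimal {l : Filter Levels} {P Q : Measure (Path E)}
    [IsProbabilityMeasure P] {Z : ℕ → Path E → ℝ}
    (hZ : IsLogLik P Q Z) {c : ℝ} (hc0 : 0 < c)
    (hc : ∀ ρ : ℝ, c < ρ →
      Tendsto (fun n : ℕ => P {ω | ∃ m : ℕ, 1 ≤ m ∧ m ≤ n ∧ (n : ℝ) * ρ ≤ Z m ω}) atTop (𝓝 0))
    (g : Finset (Fin K) → Prop) {e r : Levels → ℝ}
    (hcls : ∀ v T D, M.InClass v T D → Q {ω | T ω ≠ ⊤ ∧ g (D ω)} ≤ ENNReal.ofReal (e v) ∧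
      P {ω | T ω ≠ ⊤ ∧ ¬ g (D ω)} ≤ ENNReal.ofReal (r v))
    (he : Tendsto e l (𝓝[>] 0)) (hr : Tendsto r l (𝓝 0)) {ρ : ℝ} (hρ : c < ρ) :
    ∀ᶠ v in l, ENNReal.ofReal (|Real.log (e v)| / ρ) ≤ M.optimal P v := by
  -- With $c<\rho_1<\rho_2<\rho$, the horizon is $n=\lfloor L/\rho_2\rfloor$ and the likelihood
  -- level is $n\rho_1$. The gap $\rho_1<\rho_2$ makes $e^{n\rho_1}e^{-L}$ vanish.
  obtain ⟨ρ₁, h1, h1'⟩ := exists_between hρ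
  obtain ⟨ρ₂, h2, h2'⟩ := exists_between h1'
  have p1 : 0 < ρ₁ := hc0.trans h1
  have p2 : 0 < ρ₂ := p1.trans h2
  have p3 : 0 < ρ := p2.trans h2'
  -- Eventually $T>n$ has probability at least $q$. Since $q/\rho_2>1/\rho$, the product $nq$
  -- exceeds $L/\rho$ for large $L$ despite the rounding of $n$.
  obtain ⟨q, hq, hq'⟩ := exists_between ((div_lt_one p3).2 h2')
  have hq0 : 0 < q := (div_pos p2 p3).trans hq
  have hL := tendsto_abs_log he
  set L : Levels → ℝ := fun v => |Real.log (e v)| with hLdef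
  have hn : Tendsto (fun v => ⌊L v / ρ₂⌋₊) l atTop :=
    tendsto_nat_floor_atTop.comp (hL.atTop_div_const p2)
  have hexp : Tendsto (fun v => ENNReal.ofReal (Real.exp (-((1 - ρ₁ / ρ₂) * L v)))) l (𝓝 0) := by
    have hpos : 0 < 1 - ρ₁ / ρ₂ := by rw [sub_pos, div_lt_one p2]; exact h2
    have := ENNReal.tendsto_ofReal
      (Real.tendsto_exp_neg_atTop_nhds_zero.comp (hL.const_mul_atTop hpos))
    simpa using this
  have hr' : Tendsto (fun v => ENNReal.ofReal (r v)) l (𝓝 0) := by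
    simpa using ENNReal.tendsto_ofReal hr
  have hb := (((hc ρ₁ h1).comp hn).add hexp).add hr'
  rw [add_zero, add_zero] at hb
  have hq1 : (0 : ENNReal) < ENNReal.ofReal (1 - q) := ENNReal.ofReal_pos.2 (by linarith)
  have hk : 0 < q / ρ₂ - 1 / ρ := by
    rw [sub_pos, div_lt_div_iff₀ p3 p2]
    rw [div_lt_iff₀ p3] at hq
    linarith
  filter_upwards [hb.eventually_lt_const hq1, hL.eventually_ge_atTop (q / (q / ρ₂ - 1 / ρ)),
    he self_mem_nhdsWithin, (tendsto_nhdsWithin_iff.1 he).1.eventually_lt_const one_pos]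
    with v hv hLv hev hev1
  have hev0 : 0 < e v := hev
  set n := ⌊L v / ρ₂⌋₊ with hndef
  have hL0 : 0 ≤ L v := abs_nonneg _
  have hnle : (n : ℝ) ≤ L v / ρ₂ := Nat.floor_le (div_nonneg hL0 p2.le)
  have hnge : L v / ρ₂ - 1 ≤ n := (Nat.sub_one_lt_floor _).le
  refine le_sInf ?_
  rintro t ⟨T, D, hTD, rfl⟩
  obtain ⟨hQ, hP⟩ := hcls v T D hTD
  have hloge : e v = Real.exp (-L v) := by
    rw [hLdef]
    simp only
    rw [abs_of_neg (Real.log_neg hev0 hev1), neg_neg, Real.exp_log hev0]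
  have hprob : P {ω | T ω ≤ n} ≤ ENNReal.ofReal (1 - q) := by
    refine le_trans ?_ hv.le
    have hsub : {ω | T ω ≤ n} ⊆ {ω | T ω ≤ n ∧ g (D ω)} ∪ {ω | T ω ≠ ⊤ ∧ ¬ g (D ω)} := by
      intro ω hω
      by_cases hg : g (D ω)
      · exact Or.inl ⟨hω, hg⟩
      · exact Or.inr ⟨ne_top_of_le_ne_top (ENat.natCast_ne_top n) hω, hg⟩
    refine (measure_mono hsub).trans ((measure_union_le _ _).trans ?_)
    refine add_le_add ?_ hP
    refine (prob_stop_le hTD.1 hZ g n (n * ρ₁)).trans ?_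
    refine add_le_add le_rfl ?_
    calc ENNReal.ofReal (Real.exp (n * ρ₁)) * Q {ω | T ω ≠ ⊤ ∧ g (D ω)}
        ≤ ENNReal.ofReal (Real.exp (n * ρ₁)) * ENNReal.ofReal (e v) := by gcongr
      _ = ENNReal.ofReal (Real.exp (n * ρ₁ + -L v)) := by
          rw [← ENNReal.ofReal_mul (Real.exp_pos _).le, hloge, ← Real.exp_add]
      _ ≤ _ := by
          refine ENNReal.ofReal_le_ofReal (Real.exp_le_exp.2 ?_)
          have : (n : ℝ) * ρ₁ ≤ L v / ρ₂ * ρ₁ := mul_le_mul_of_nonneg_right hnle p1.le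
          calc (n : ℝ) * ρ₁ + -L v ≤ L v / ρ₂ * ρ₁ + -L v := by linarith
            _ = _ := by ring
  refine le_trans ?_ (mul_le_expect hTD.1 P n)
  have h1q : ENNReal.ofReal q ≤ 1 - P {ω | T ω ≤ n} := by
    refine le_trans ?_ (tsub_le_tsub_left hprob 1)
    rw [← ENNReal.ofReal_one, ← ENNReal.ofReal_sub _ (by linarith)]
    exact ENNReal.ofReal_le_ofReal (by linarith)
  calc ENNReal.ofReal (L v / ρ) ≤ ENNReal.ofReal (n * q) := by
        refine ENNReal.ofReal_le_ofReal ?_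
        rw [div_le_iff₀ hk] at hLv
        have : (L v / ρ₂ - 1) * q ≤ n * q := mul_le_mul_of_nonneg_right hnge hq0.le
        calc L v / ρ = L v * (q / ρ₂) - L v * (q / ρ₂ - 1 / ρ) := by ring
          _ ≤ L v * (q / ρ₂) - q := by linarith
          _ = (L v / ρ₂ - 1) * q := by ring
          _ ≤ _ := this
    _ = n * ENNReal.ofReal q := by
        rw [ENNReal.ofReal_mul (Nat.cast_nonneg n), ENNReal.ofReal_natCast]
    _ ≤ _ := by gcongr

lemma tendsto_info_excess {s : Finset (Fin K)} {P : Measure (Path E)} {ν : Measure (Traj E s)}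
    {c : ℝ} (h : IsInfo (marg s P) ν c) (ρ : ℝ) (hρ : c < ρ) :
    Tendsto (fun n : ℕ => P {ω | ∃ m : ℕ, 1 ≤ m ∧ m ≤ n ∧
      (n : ℝ) * ρ ≤ logLik m (marg s P) ν (restr s ω)}) atTop (𝓝 0) :=
  tendsto_of_tendsto_of_tendsto_of_le_of_le tendsto_const_nhds (h.2.1 ρ hρ)
    (fun _ => zero_le) (fun _ => Measure.le_map_apply (measurable_restr s).aemeasurable _)

end LowerBound

end SeqMulti

namespace SeqMulti

/-! ### Expected sample size of the proposed test. -/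

section UpperBound

/-- If $T>j$, every $n$ with $N\le n<j$ must be a bad time, so $T$ is at most $N+1$ plus the number
of bad times. No independence between times is needed. -/
lemma lintegral_enat_le {Ω : Type*} [MeasurableSpace Ω] {P : Measure Ω} {T : Ω → ℕ∞}
    {b : ℕ → Set Ω} {N : ℕ}
    (h : ∀ᵐ ω ∂P, ∀ n : ℕ, N ≤ n → ω ∉ b n → T ω ≤ (n + 1 : ℕ)) [IsProbabilityMeasure P] :
    ∫⁻ ω, (T ω : ENNReal) ∂P ≤ N + 1 + ∑' n, P (b n) := by
  -- Measurable hulls have the same measure, so the bad sets need not be measurable.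
  set f : ℕ → Ω → ENNReal := fun n => (toMeasurable P (b n)).indicator 1 with hf
  have hpt : ∀ᵐ ω ∂P, (T ω : ENNReal) ≤ N + 1 + ∑' n, f n ω := by
    filter_upwards [h] with ω hω
    have key : ∀ j : ℕ, (j : ℕ∞) < T ω → (j : ENNReal) ≤ N + ∑' n, f n ω := by
      intro j hj
      have hmem : ∀ n ∈ Finset.Ico N j, 1 ≤ f n ω := by
        intro n hn
        rw [Finset.mem_Ico] at hn
        have hb : ω ∈ b n := by
          by_contra hnb
          have h1 := lt_of_lt_of_le hj (hω n hn.1 hnb)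
          have h2 : j < n + 1 := by exact_mod_cast h1
          omega
        rw [hf]
        simp only
        rw [Set.indicator_of_mem (subset_toMeasurable P _ hb)]
        exact le_rfl
      calc (j : ENNReal) ≤ N + ((j - N : ℕ) : ENNReal) := by
            exact_mod_cast (by omega : j ≤ N + (j - N))
        _ = N + ∑ n ∈ Finset.Ico N j, (1 : ENNReal) := by simp
        _ ≤ N + ∑ n ∈ Finset.Ico N j, f n ω := by
            gcongr with n hn; exact hmem n hn
        _ ≤ _ := by gcongr; exact ENNReal.sum_le_tsum _
    rcases eq_or_ne (T ω) ⊤ with ht | ht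
    -- If $T=\infty$, all times from $N$ on are bad and the count is infinite.
    · have : (N : ENNReal) + ∑' n, f n ω = ⊤ := by
        refine ENNReal.eq_top_of_forall_nnreal_le fun r => ?_
        refine le_trans ?_ (key ⌈r⌉₊ (by rw [ht]; exact ENat.natCast_lt_top _))
        exact_mod_cast Nat.le_ceil r
      rw [add_right_comm, this]
      simp
    · obtain ⟨m, hm⟩ := ENat.ne_top_iff_exists.1 ht
      rw [← hm]
      rcases m with _ | j
      · simp
      · have := key j (by rw [← hm]; exact_mod_cast Nat.lt_succ_self j)
        rw [add_right_comm]
        push_cast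
        gcongr
  refine (lintegral_mono_ae hpt).trans ?_
  rw [lintegral_add_left measurable_const, lintegral_const, measure_univ, mul_one,
    lintegral_tsum fun n =>
      (measurable_one.indicator (measurableSet_toMeasurable P (b n))).aemeasurable]
  gcongr with n
  rw [lintegral_indicator_one (measurableSet_toMeasurable _ _), measure_toMeasurable]

lemma tsum_measure_union_ne_top {Ω : Type*} [MeasurableSpace Ω] {P : Measure Ω}
    {b c : ℕ → Set Ω} (hb : ∑' n, P (b n) ≠ ⊤) (hc : ∑' n, P (c n) ≠ ⊤) :
    ∑' n, P (b n ∪ c n) ≠ ⊤ := by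
  refine ne_top_of_le_ne_top (ENNReal.add_ne_top.2 ⟨hb, hc⟩) ?_
  rw [← ENNReal.tsum_add]
  exact ENNReal.tsum_le_tsum fun n => measure_union_le _ _

lemma tsum_measure_biUnion_ne_top {Ω ι : Type*} [MeasurableSpace Ω] {P : Measure Ω}
    {I : Set ι} (hI : I.Finite) {b : ι → ℕ → Set Ω} (hb : ∀ i ∈ I, ∑' n, P (b i n) ≠ ⊤) :
    ∑' n, P (⋃ i ∈ I, b i n) ≠ ⊤ := by
  have hle : ∀ n, P (⋃ i ∈ I, b i n) ≤ ∑ i ∈ hI.toFinset, P (b i n) := fun n => by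
    refine le_trans (measure_mono ?_) (measure_biUnion_finset_le hI.toFinset fun i => b i n)
    simp
  refine ne_top_of_le_ne_top ?_ (ENNReal.tsum_le_tsum hle)
  rw [Summable.tsum_finsetSum fun _ _ => ENNReal.summable]
  exact ENNReal.sum_ne_top.2 fun i hi => hb i (hI.mem_toFinset.1 hi)

lemma exists_pos_forall_lt {ι : Type*} {I : Set ι} (hI : I.Finite) {f : ι → ℝ}
    (hf : ∀ i ∈ I, 0 < f i) : ∃ ρ : ℝ, 0 < ρ ∧ ∀ i ∈ I, ρ < f i := by
  have hev : ∀ᶠ ρ in 𝓝[>] (0 : ℝ), 0 < ρ ∧ ∀ i ∈ I, ρ < f i := by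
    refine (eventually_mem_nhdsWithin (a := (0 : ℝ)) (s := Set.Ioi 0)).and ?_
    exact (hI.eventually_all).2 fun i hi =>
      nhdsWithin_le_nhds (Iio_mem_nhds (hf i hi))
  exact hev.exists

variable {K : ℕ} {E : Fin K → Type*} [∀ i, MeasurableSpace (E i)] {M : Problem E}

/-- The event that the log-likelihood ratio of `P^s` against `Q^s` is below `ρ` per observation at
time `n + 1`. -/
def lagSet (s : Finset (Fin K)) (P Q : Measure (Path E)) (ρ : ℝ) (n : ℕ) : Set (Path E) :=
  {ω | logLik (n + 1) (marg s P) (marg s Q) (restr s ω) < ((n + 1 : ℕ) : ℝ) * ρ}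

lemma tsum_lagSet_ne_top {s : Finset (Fin K)} {P Q : Measure (Path E)}
    (h : ∃ c, IsInfo (marg s P) (marg s Q) c) {ρ : ℝ}
    (hρ : ρ < info (marg s P) (marg s Q)) : ∑' n, P (lagSet s P Q ρ n) ≠ ⊤ :=
  ne_top_of_le_ne_top ((isInfo_info h).2.2 ρ hρ) (ENNReal.tsum_le_tsum fun _ =>
    Measure.le_map_apply (measurable_restr s).aemeasurable _)

lemma lik_le_maxLik {s : Finset (Fin K)} {𝒬 : Set (Measure (Path E))} (hf : 𝒬.Finite)
    {P : Measure (Path E)} (hP : P ∈ 𝒬) (R : Measure (Path E)) (n : ℕ) (ω : Path E) :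
    lik n (marg s P) (marg s R) (restr s ω) ≤ Problem.maxLik s 𝒬 R n ω :=
  le_csSup (hf.image _).bddAbove ⟨P, hP, rfl⟩

lemma exists_lik_eq_maxLik {s : Finset (Fin K)} {𝒬 : Set (Measure (Path E))} (hf : 𝒬.Finite)
    (hne : 𝒬.Nonempty) (R : Measure (Path E)) (n : ℕ) (ω : Path E) :
    ∃ Q ∈ 𝒬, lik n (marg s Q) (marg s R) (restr s ω) = Problem.maxLik s 𝒬 R n ω :=
  (hne.image _).csSup_mem (hf.image _)

/-- The maximal likelihoods over `𝒢` and `ℋ` are positive at `ω`, and their ratio is at least `e^y`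
when all the log-likelihood ratios of `P` against `ℋ` are at least `y`. -/
def LikDominates (s : Finset (Fin K)) (𝒢 ℋ : Set (Measure (Path E))) (P R : Measure (Path E))
    (n : ℕ) (ω : Path E) : Prop :=
  0 < Problem.maxLik s 𝒢 R n ω ∧ 0 < Problem.maxLik s ℋ R n ω ∧
    ∀ y, (∀ Q ∈ ℋ, y ≤ logLik n (marg s P) (marg s Q) (restr s ω)) →
      Real.exp y * Problem.maxLik s ℋ R n ω ≤ Problem.maxLik s 𝒢 R n ω

/-- The maximum over `ℋ` is attained at some $Q$ depending on the path. Finiteness of `ℋ` makes the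
chain rule hold for all $Q$ simultaneously almost surely, and $P\in$ `𝒢` bounds the other maximum
from below. -/
lemma ae_likDominates {s : Finset (Fin K)} {𝒢 ℋ : Set (Measure (Path E))} (h𝒢 : 𝒢.Finite)
    (hℋ : ℋ.Finite) (hne : ℋ.Nonempty) {P R : Measure (Path E)} (hP : P ∈ 𝒢)
    [IsProbabilityMeasure P] [IsProbabilityMeasure R]
    (hprob : ∀ Q ∈ ℋ, IsProbabilityMeasure Q)
    (hPQ : ∀ Q ∈ ℋ, LocallyEquivalent (marg s P) (marg s Q))
    (hPR : LocallyEquivalent (marg s P) (marg s R)) (n : ℕ) :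
    ∀ᵐ ω ∂P, LikDominates s 𝒢 ℋ P R n ω := by
  have hpos : ∀ Q : Measure (Path E), IsProbabilityMeasure Q →
      LocallyEquivalent (marg s P) (marg s Q) →
      ∀ᵐ ω ∂P, 0 < lik n (marg s Q) (marg s R) (restr s ω) := fun Q hQ h =>
    ae_of_ae_map (measurable_restr s).aemeasurable (ae_lik_pos h (h.symm.trans hPR) n)
  have hexp : ∀ᵐ ω ∂P, ∀ Q ∈ ℋ, ∀ y, y ≤ logLik n (marg s P) (marg s Q) (restr s ω) →
      Real.exp y * lik n (marg s Q) (marg s R) (restr s ω) ≤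
        lik n (marg s P) (marg s R) (restr s ω) := by
    rw [ae_ball_iff hℋ.countable]
    intro Q hQ
    have := hprob Q hQ
    exact ae_of_ae_map (measurable_restr s).aemeasurable (ae_exp_mul_lik_le hPR (hPQ Q hQ) n)
  obtain ⟨Q₀, hQ₀⟩ := hne
  filter_upwards [hpos P inferInstance (LocallyEquivalent.refl _),
    hpos Q₀ (hprob Q₀ hQ₀) (hPQ Q₀ hQ₀), hexp] with ω h1 h2 h3
  refine ⟨h1.trans_le (lik_le_maxLik h𝒢 hP R n ω), h2.trans_le (lik_le_maxLik hℋ hQ₀ R n ω),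
    fun y hy => ?_⟩
  obtain ⟨Q, hQ, hQe⟩ := exists_lik_eq_maxLik (s := s) hℋ ⟨Q₀, hQ₀⟩ R n ω
  rw [← hQe]
  exact (h3 Q hQ y (hy Q hQ)).trans (lik_le_maxLik h𝒢 hP R n ω)

/-- As $T^*\le T_{\rm joint}$, only the joint rule has to be met. The thresholds must exceed $1$,
because $D_{\rm iso}$ compares with $1$: only then does clearing the thresholds force $D_{\rm
iso}(n)$ to be `A`. -/
lemma stopStar_le {d : Problem.Design E} {A : Finset (Fin K)} (hA : A ∈ M.Ψ) {k₀ : Fin K}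
    (hk₀ : k₀ ∈ A) {n : ℕ} (hn : 1 ≤ n) {v : Levels} {ω : Path E}
    (hin : ∀ k ∈ A, 1 < d.thr.B k v ∧
      d.thr.B k v ≤ M.isoStat (d.isoSub k) (d.isoRef k) k n ω)
    (hout : ∀ k ∉ A, 1 < d.thr.A k v ∧
      M.isoStat (d.isoSub k) (d.isoRef k) k n ω ≤ 1 / d.thr.A k v)
    (hdet : d.thr.D k₀ v ≤ M.detStat (d.detSub k₀) (d.detRef k₀) k₀ n ω) :
    M.stopStar d v ω ≤ n := by
  refine (min_le_right _ _).trans (sInf_le ⟨n, rfl, hn, ⟨k₀, hdet⟩, fun k hk => ?_, ?_⟩)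
  · by_cases hkA : k ∈ A
    · exact (hin k hkA).2.not_gt hk.2
    · exact (hout k hkA).2.not_gt hk.1
  · have hset : M.isoSet d n ω = A := by
      ext k
      simp only [Problem.isoSet, Finset.mem_filter, Finset.mem_univ, true_and]
      by_cases hkA : k ∈ A
      · exact ⟨fun _ => hkA, fun _ => (hin k hkA).1.trans_le (hin k hkA).2⟩
      · refine ⟨fun h => absurd h (not_lt.2 ((hout k hkA).2.trans ?_)), fun h => absurd h hkA⟩
        have := (hout k hkA).1
        rw [div_le_one (by linarith)]
        exact this.le
    rw [hset]
    exact ⟨hA, fun h => by simp_all⟩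

lemma Problem.compat_finite (M : Problem E) : M.compat.Finite :=
  M.plaus_finite.subset fun _ h => h.1

lemma Problem.altAt_finite (M : Problem E) (k : Fin K) : (M.altAt k).Finite :=
  M.compat_finite.subset fun _ h => h.1

lemma Problem.nullAt_finite (M : Problem E) (k : Fin K) : (M.nullAt k).Finite :=
  M.compat_finite.subset fun _ h => h.1.1

lemma Problem.globalNull_finite (M : Problem E) : M.globalNull.Finite :=
  M.plaus_finite.subset fun _ h => h.1

/-- The expected sample size of the proposed test, when the thresholds are crossed by time `x` on
the event that the log-likelihood ratios grow at the rates `ρ₁` and `ρ₂`. -/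
lemma exists_expect_stopStar_le {d : Problem.Design E} (h_nullAt : ∀ k, (M.nullAt k).Nonempty)
    (h_altAt : ∀ k, (M.altAt k).Nonempty) (h_ac : M.AbsContAssumption) (h_info : M.InfoAssumption)
    (h_adm : M.Admissible d) (h_iso : ∀ k, d.isoSub k = {k}) {P : Measure (Path E)}
    (hP : P ∈ M.compat \ M.globalNull) {k₀ : Fin K} (hk₀ : k₀ ∈ M.signals P) {ρ₁ ρ₂ : ℝ}
    (hρ₁ : ∀ k ∈ M.signals P, ∀ Q ∈ M.nullAt k, ρ₁ < info (marg {k} P) (marg {k} Q))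
    (hρ₂ : ∀ k ∉ M.signals P, ∀ Q ∈ M.altAt k, ρ₂ < info (marg {k} P) (marg {k} Q))
    (h₁ : 0 < ρ₁) (h₂ : 0 < ρ₂) :
    ∃ ρ₃ : ℝ, 0 < ρ₃ ∧ ∃ C : ENNReal, C ≠ ⊤ ∧ ∀ v : Levels, v.InUnit → ∀ x : ℝ, 0 ≤ x →
      (∀ k, 0 < Real.log (d.thr.A k v)) → (∀ k, 0 < Real.log (d.thr.B k v)) →
      (∀ k ∈ M.signals P, Real.log (d.thr.B k v) ≤ x * ρ₁) →
      (∀ k ∉ M.signals P, Real.log (d.thr.A k v) ≤ x * ρ₂) →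
      Real.log (d.thr.D k₀ v) ≤ x * ρ₃ →
      Problem.expect P (M.stopStar d v) ≤ ENNReal.ofReal x + C := by
  have hPp : IsProbabilityMeasure P := M.plaus_prob P hP.1.1
  have hPalt : ∀ k ∈ M.signals P, P ∈ M.altAt k := fun k hk => ⟨hP.1, hk⟩
  have hPnull : ∀ k ∉ M.signals P, P ∈ M.nullAt k := fun k hk => ⟨hP, hk⟩
  have hpn : ∀ k, ∀ Q ∈ M.nullAt k, IsProbabilityMeasure Q := fun k Q hQ =>
    M.plaus_prob Q hQ.1.1.1
  have hpa : ∀ k, ∀ Q ∈ M.altAt k, IsProbabilityMeasure Q := fun k Q hQ =>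
    M.plaus_prob Q hQ.1.1
  have hp0 : ∀ Q ∈ M.globalNull, IsProbabilityMeasure Q := fun Q hQ => M.plaus_prob Q hQ.1
  have hself : ∀ k : Fin K, k ∈ ({k} : Finset (Fin K)) := Finset.mem_singleton_self
  -- Detection has to succeed for the single source `k₀` only, and any positive rate will do.
  obtain ⟨ρ₃, h₃, hρ₃⟩ := exists_pos_forall_lt M.globalNull_finite
    (f := fun Q => info (marg (d.detSub k₀) P) (marg (d.detSub k₀) Q)) fun Q hQ =>
      (isInfo_info (h_info k₀ P (hPalt k₀ hk₀) Q (Or.inr hQ) _ (h_adm.mem_detSub k₀)).1).1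
  set b₁ : ℕ → Set (Path E) := fun n =>
    ⋃ k ∈ {k | k ∈ M.signals P}, ⋃ Q ∈ M.nullAt k, lagSet {k} P Q ρ₁ n with hb₁
  set b₂ : ℕ → Set (Path E) := fun n =>
    ⋃ k ∈ {k | k ∉ M.signals P}, ⋃ Q ∈ M.altAt k, lagSet {k} P Q ρ₂ n with hb₂
  set b₃ : ℕ → Set (Path E) := fun n =>
    ⋃ Q ∈ M.globalNull, lagSet (d.detSub k₀) P Q ρ₃ n with hb₃
  have s₁ : ∑' n, P (b₁ n) ≠ ⊤ := tsum_measure_biUnion_ne_top (Set.toFinite _) fun k hk =>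
    tsum_measure_biUnion_ne_top (M.nullAt_finite k) fun Q hQ => tsum_lagSet_ne_top
      (h_info k P (hPalt k hk) Q (Or.inl hQ) _ (hself k)).1 (hρ₁ k hk Q hQ)
  have s₂ : ∑' n, P (b₂ n) ≠ ⊤ := tsum_measure_biUnion_ne_top (Set.toFinite _) fun k hk =>
    tsum_measure_biUnion_ne_top (M.altAt_finite k) fun Q hQ => tsum_lagSet_ne_top
      (h_info k Q hQ P (Or.inl (hPnull k hk)) _ (hself k)).2 (hρ₂ k hk Q hQ)
  have s₃ : ∑' n, P (b₃ n) ≠ ⊤ := tsum_measure_biUnion_ne_top M.globalNull_finite fun Q hQ =>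
    tsum_lagSet_ne_top
      (h_info k₀ P (hPalt k₀ hk₀) Q (Or.inr hQ) _ (h_adm.mem_detSub k₀)).1 (hρ₃ Q hQ)
  have hs := tsum_measure_union_ne_top (tsum_measure_union_ne_top s₁ s₂) s₃
  -- The $2$ pays for rounding `x` up and for the shift from $n$ to $n+1$.
  refine ⟨ρ₃, h₃, 2 + ∑' n, P ((b₁ n ∪ b₂ n) ∪ b₃ n),
    ENNReal.add_ne_top.2 ⟨ENNReal.ofNat_ne_top, hs⟩, ?_⟩
  intro v hv x hx hA hB hxB hxA hxD
  have hbound : ∀ ρ : ℝ, 0 < ρ → ∀ n : ℕ, ⌈x⌉₊ ≤ n → x * ρ ≤ ((n + 1 : ℕ) : ℝ) * ρ := by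
    intro ρ hρ n hn
    refine mul_le_mul_of_nonneg_right ?_ hρ.le
    have := Nat.ceil_le.1 hn
    push_cast
    linarith
  have hae₁ : ∀ᵐ ω ∂P, ∀ n : ℕ, ∀ k ∈ {k | k ∈ M.signals P},
      LikDominates {k} (M.altAt k) (M.nullAt k) P (d.isoRef k) (n + 1) ω :=
    ae_all_iff.2 fun n => (ae_ball_iff (Set.to_countable _)).2 fun k hk =>
      have := hp0 _ (h_adm.isoRef_mem k)
      ae_likDominates (s := {k}) (M.altAt_finite k) (M.nullAt_finite k) (h_nullAt k) (hPalt k hk)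
        (R := d.isoRef k) (hpn k)
        (fun Q hQ => h_ac k P (Or.inl (hPalt k hk)) Q (Or.inl hQ) _ (hself k))
        (h_ac k P (Or.inl (hPalt k hk)) _ (Or.inr (h_adm.isoRef_mem k)) _ (hself k)) (n + 1)
  -- For a source that is no signal, $P$ belongs to $\mathcal H_{\Psi,k}$, so the two families
  -- exchange roles.
  have hae₂ : ∀ᵐ ω ∂P, ∀ n : ℕ, ∀ k ∈ {k | k ∉ M.signals P},
      LikDominates {k} (M.nullAt k) (M.altAt k) P (d.isoRef k) (n + 1) ω :=
    ae_all_iff.2 fun n => (ae_ball_iff (Set.to_countable _)).2 fun k hk =>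
      have := hp0 _ (h_adm.isoRef_mem k)
      ae_likDominates (s := {k}) (M.nullAt_finite k) (M.altAt_finite k) (h_altAt k) (hPnull k hk)
        (R := d.isoRef k) (hpa k)
        (fun Q hQ => (h_ac k Q (Or.inl hQ) P (Or.inl (hPnull k hk)) _ (hself k)).symm)
        (h_ac k _ (Or.inr (h_adm.isoRef_mem k)) P (Or.inl (hPnull k hk)) _ (hself k)).symm (n + 1)
  have hae₃ : ∀ᵐ ω ∂P, ∀ n : ℕ,
      LikDominates (d.detSub k₀) (M.altAt k₀) M.globalNull P (d.detRef k₀) (n + 1) ω :=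
    ae_all_iff.2 fun n =>
      have := hp0 _ (h_adm.detRef_mem k₀)
      ae_likDominates (s := d.detSub k₀) (M.altAt_finite k₀) M.globalNull_finite
        ⟨_, h_adm.detRef_mem k₀⟩ (hPalt k₀ hk₀) (R := d.detRef k₀) hp0
        (fun Q hQ => h_ac k₀ P (Or.inl (hPalt k₀ hk₀)) Q (Or.inr hQ) _ (h_adm.mem_detSub k₀))
        (h_ac k₀ P (Or.inl (hPalt k₀ hk₀)) _ (Or.inr (h_adm.detRef_mem k₀)) _
          (h_adm.mem_detSub k₀)) (n + 1)
  have hmain : ∀ᵐ ω ∂P, ∀ n : ℕ, ⌈x⌉₊ ≤ n → ω ∉ (b₁ n ∪ b₂ n) ∪ b₃ n →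
      M.stopStar d v ω ≤ (n + 1 : ℕ) := by
    filter_upwards [hae₁, hae₂, hae₃] with ω g₁ g₂ g₃ n hn hω
    simp only [hb₁, hb₂, hb₃, lagSet, Set.mem_union, Set.mem_iUnion, Set.mem_ofPred_eq, not_or,
      not_exists, not_lt, exists_prop, not_and] at hω
    obtain ⟨⟨e₁, e₂⟩, e₃⟩ := hω
    refine stopStar_le hP.1.2.2 hk₀ (Nat.le_add_left 1 n) ?_ ?_ ?_
    · intro k hk
      have hpos := (h_adm.pos k v hv).2.1
      refine ⟨(Real.log_pos_iff hpos.le).1 (hB k), ?_⟩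
      obtain ⟨_, p, hy⟩ := g₁ n k hk
      rw [h_iso, Problem.isoStat, le_div_iff₀ p]
      refine le_trans (mul_le_mul_of_nonneg_right ?_ p.le) (hy _ (e₁ k hk))
      rw [← Real.log_le_iff_le_exp hpos]
      exact (hxB k hk).trans (hbound _ h₁ n hn)
    · intro k hk
      have hpos := (h_adm.pos k v hv).1
      refine ⟨(Real.log_pos_iff hpos.le).1 (hA k), ?_⟩
      obtain ⟨p, _, hy⟩ := g₂ n k hk
      rw [h_iso, Problem.isoStat, div_le_div_iff₀ p hpos, one_mul, mul_comm]
      refine le_trans (mul_le_mul_of_nonneg_right ?_ (by positivity)) (hy _ (e₂ k hk))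
      rw [← Real.log_le_iff_le_exp hpos]
      exact (hxA k hk).trans (hbound _ h₂ n hn)
    · have hpos := (h_adm.pos k₀ v hv).2.2.2
      obtain ⟨_, p, hy⟩ := g₃ n
      rw [Problem.detStat, le_div_iff₀ p]
      refine le_trans (mul_le_mul_of_nonneg_right ?_ p.le) (hy _ e₃)
      rw [← Real.log_le_iff_le_exp hpos]
      exact hxD.trans (hbound _ h₃ n hn)
  refine (lintegral_enat_le hmain).trans ?_
  rw [← add_assoc]
  refine add_le_add ?_ le_rfl
  calc ((⌈x⌉₊ : ℕ) : ENNReal) + 1 ≤ ENNReal.ofReal (x + 1) + 1 := by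
        gcongr
        rw [← ENNReal.ofReal_natCast]
        exact ENNReal.ofReal_le_ofReal (Nat.ceil_lt_add_one hx).le
    _ = ENNReal.ofReal x + 2 := by
        rw [ENNReal.ofReal_add hx zero_le_one, ENNReal.ofReal_one, add_assoc, one_add_one_eq_two]

end UpperBound

end SeqMulti

namespace SeqMulti

/-! ### Passage to the limit in the error levels. -/

section Asymptotics

variable {l : Filter Levels}

lemma tendsto_levels (hl : l ≤ Levels.toZero) :
    Tendsto Levels.α l (𝓝[>] 0) ∧ Tendsto Levels.β l (𝓝[>] 0) ∧
      Tendsto Levels.γ l (𝓝[>] 0) ∧ Tendsto Levels.δ l (𝓝[>] 0) := by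
  have h4 : l ≤ comap Levels.δ (𝓝[>] 0) := hl.trans inf_le_right
  have h3' := hl.trans (inf_le_left : Levels.toZero ≤ _)
  have h2' := h3'.trans inf_le_left
  exact ⟨tendsto_iff_comap.2 (h2'.trans inf_le_left), tendsto_iff_comap.2 (h2'.trans inf_le_right),
    tendsto_iff_comap.2 (h3'.trans inf_le_right), tendsto_iff_comap.2 h4⟩

lemma eventually_inUnit (hl : l ≤ Levels.toZero) : ∀ᶠ v in l, v.InUnit := by
  have h : ∀ᶠ t in 𝓝[>] (0 : ℝ), t ∈ Set.Ioo (0 : ℝ) 1 := Ioo_mem_nhdsGT one_pos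
  obtain ⟨h1, h2, h3, h4⟩ := tendsto_levels hl
  filter_upwards [h1.eventually h, h2.eventually h, h3.eventually h, h4.eventually h]
    with v a b c e using ⟨a, b, c, e⟩

lemma eventually_le_mul_of_isEquivalent {f L : Levels → ℝ} (h : f ~[l] L)
    (hL : Tendsto L l atTop) {c : ℝ} (hc : 1 < c) : ∀ᶠ v in l, f v ≤ L v * c := by
  filter_upwards [h.bound (sub_pos.2 hc), hL.eventually_ge_atTop 0] with v hv h0
  rw [Pi.sub_apply, Real.norm_eq_abs, Real.norm_eq_abs, abs_of_nonneg h0] at hv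
  have := (abs_le.1 hv).2
  linarith

lemma eventually_le_mul_of_isLittleO {f L : Levels → ℝ} (h : f =o[l] L)
    (hL : Tendsto L l atTop) {c : ℝ} (hc : 0 < c) : ∀ᶠ v in l, f v ≤ L v * c := by
  filter_upwards [h.bound hc, hL.eventually_ge_atTop 0] with v hv h0
  rw [Real.norm_eq_abs, Real.norm_eq_abs, abs_of_nonneg h0] at hv
  have := (abs_le.1 hv).2
  linarith

lemma isLittleO_of_max {f g L : Levels → ℝ}
    (h : (fun v => max |f v| |g v|) =o[l] L) :
    (fun v => |f v|) =o[l] L ∧ (fun v => |g v|) =o[l] L := by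
  constructor <;> refine IsBigO.trans_isLittleO (IsBigO.of_bound 1 ?_) h <;>
    refine Eventually.of_forall fun v => ?_ <;>
    rw [one_mul, Real.norm_of_nonneg (abs_nonneg _),
      Real.norm_of_nonneg ((abs_nonneg _).trans (le_max_left _ _))]
  · exact le_max_left _ _
  · exact le_max_right _ _

variable {K : ℕ} {E : Fin K → Type*} [∀ i, MeasurableSpace (E i)] {M : Problem E}
  {d : Problem.Design E} {P : Measure (Path E)}

/-- The scale `L` cancels: the rates $\rho_0-t$ and $c+t$ bound the quotient by $(c+t)/(\rho_0-t)$,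
and $t\downarrow0$. -/
lemma ARE_le {L : Levels → ℝ} (hL : Tendsto L l atTop) {c ρ₀ : ℝ} (hc : 0 < c) (hρ₀ : 0 < ρ₀)
    (hup : ∀ ρ, 0 < ρ → ρ < ρ₀ →
      ∀ᶠ v in l, Problem.expect P (M.stopStar d v) ≤ ENNReal.ofReal (L v / ρ))
    (hlow : ∀ ρ, c < ρ → ∀ᶠ v in l, ENNReal.ofReal (L v / ρ) ≤ M.optimal P v) :
    M.ARE d P l ≤ ENNReal.ofReal (c / ρ₀) := by
  have hlim : Tendsto (fun t : ℝ => ENNReal.ofReal ((c + t) / (ρ₀ - t))) (𝓝[>] 0)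
      (𝓝 (ENNReal.ofReal (c / ρ₀))) := by
    have : ContinuousAt (fun t : ℝ => (c + t) / (ρ₀ - t)) 0 :=
      ContinuousAt.div (by fun_prop) (by fun_prop) (by simpa using hρ₀.ne')
    have h := ENNReal.tendsto_ofReal this.tendsto
    simp only [add_zero, sub_zero] at h
    exact h.mono_left nhdsWithin_le_nhds
  refine ge_of_tendsto hlim ?_
  filter_upwards [Ioo_mem_nhdsGT hρ₀] with t ht
  have h1 : 0 < ρ₀ - t := sub_pos.2 ht.2
  have h2 : 0 < c + t := add_pos hc ht.1
  refine limsup_le_of_le (by isBoundedDefault) ?_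
  filter_upwards [hup (ρ₀ - t) h1 (by linarith [ht.1]), hlow (c + t) (by linarith [ht.1]),
    hL.eventually_gt_atTop 0] with v a b hv
  refine (ENNReal.div_le_div a b).trans ?_
  rw [← ENNReal.ofReal_div_of_pos (div_pos hv h2)]
  refine ENNReal.ofReal_le_ofReal (le_of_eq ?_)
  field_simp

/-- The test $\chi^*$ competes in the infimum. Finiteness of its expectation and $T\ge1$ keep the
denominator in $[1,\infty)$, ruling out $\infty/\infty$, which is $0$ by convention. -/
lemma one_le_ARE [l.NeBot] (hl : l ≤ Levels.toZero) (h_adm : M.Admissible d)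
    [IsProbabilityMeasure P]
    (hfin : ∀ᶠ v in l, Problem.expect P (M.stopStar d v) ≠ ⊤) : 1 ≤ M.ARE d P l := by
  refine le_limsup_of_frequently_le (Eventually.frequently ?_) (by isBoundedDefault)
  filter_upwards [eventually_inUnit hl, hfin] with v hv hf
  have hle : M.optimal P v ≤ Problem.expect P (M.stopStar d v) :=
    sInf_le ⟨_, _, h_adm.inClass v hv, rfl⟩
  have h1 : 1 ≤ M.optimal P v := by
    refine le_sInf ?_
    rintro t ⟨T, D, hTD, rfl⟩
    calc (1 : ENNReal) = ∫⁻ _, 1 ∂P := by simp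
      _ ≤ Problem.expect P T := lintegral_mono fun ω => by
          have := ENat.toENNReal_le.2 (hTD.1.1 ω)
          simpa using this
  rw [ENNReal.le_div_iff_mul_le (Or.inl (zero_lt_one.trans_le h1).ne')
    (Or.inl (ne_top_of_le_ne_top hf hle)), one_mul]
  exact hle

lemma eventually_expect_stopStar_le (h_nullAt : ∀ k, (M.nullAt k).Nonempty)
    (h_altAt : ∀ k, (M.altAt k).Nonempty) (h_ac : M.AbsContAssumption) (h_info : M.InfoAssumption)
    (h_adm : M.Admissible d) (h_iso : ∀ k, d.isoSub k = {k})
    (hP : P ∈ M.compat \ M.globalNull) {k₀ : Fin K} (hk₀ : k₀ ∈ M.signals P) {ρ₁ ρ₂ : ℝ}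
    (hρ₁ : ∀ k ∈ M.signals P, ∀ Q ∈ M.nullAt k, ρ₁ < info (marg {k} P) (marg {k} Q))
    (hρ₂ : ∀ k ∉ M.signals P, ∀ Q ∈ M.altAt k, ρ₂ < info (marg {k} P) (marg {k} Q))
    (h₁ : 0 < ρ₁) (h₂ : 0 < ρ₂) (hl : l ≤ Levels.toZero) {L : Levels → ℝ}
    (hL : Tendsto L l atTop) {ρ ρ' : ℝ} (hρ : 0 < ρ) (hρ' : ρ < ρ')
    (hB : ∀ k ∈ M.signals P, ∀ᶠ v in l, Real.log (d.thr.B k v) ≤ L v * (ρ₁ / ρ'))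
    (hA : ∀ k ∉ M.signals P, ∀ᶠ v in l, Real.log (d.thr.A k v) ≤ L v * (ρ₂ / ρ'))
    (hD : (fun v => |Real.log v.α|) =o[l] L) :
    ∀ᶠ v in l, Problem.expect P (M.stopStar d v) ≤ ENNReal.ofReal (L v / ρ) := by
  obtain ⟨ρ₃, h₃, C, hC, hmain⟩ := exists_expect_stopStar_le h_nullAt h_altAt h_ac h_info h_adm
    h_iso hP hk₀ hρ₁ hρ₂ h₁ h₂
  have p' : 0 < ρ' := hρ.trans hρ'
  obtain ⟨_, _, hγ, hδ⟩ := tendsto_levels hl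
  have hApos : ∀ k, ∀ᶠ v in l, 0 < Real.log (d.thr.A k v) := fun k =>
    (((h_adm.log_A k).mono hl).symm.tendsto_atTop (tendsto_abs_log hδ)).eventually_gt_atTop 0
  have hBpos : ∀ k, ∀ᶠ v in l, 0 < Real.log (d.thr.B k v) := fun k =>
    (((h_adm.log_B k).mono hl).symm.tendsto_atTop (tendsto_abs_log hγ)).eventually_gt_atTop 0
  have hB' : ∀ᶠ v in l, ∀ k ∈ M.signals P, Real.log (d.thr.B k v) ≤ L v * (ρ₁ / ρ') :=
    (Finset.eventually_all _).2 hB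
  have hA' : ∀ᶠ v in l, ∀ k, k ∉ M.signals P → Real.log (d.thr.A k v) ≤ L v * (ρ₂ / ρ') :=
    eventually_all.2 fun k => by
      by_cases hk : k ∈ M.signals P
      · exact Eventually.of_forall fun v h => absurd hk h
      · exact (hA k hk).mono fun v h _ => h
  have hD' := eventually_le_mul_of_isLittleO
    (((h_adm.log_D k₀).mono hl).isBigO.trans_isLittleO hD) hL (div_pos h₃ p')
  -- The thresholds are crossed by time $L/\rho'$; the slack up to $L/\rho$ absorbs the constant
  -- `C`.
  have hk : 0 < 1 / ρ - 1 / ρ' := sub_pos.2 (one_div_lt_one_div_of_lt hρ hρ')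
  filter_upwards [eventually_inUnit hl, eventually_all.2 hApos, eventually_all.2 hBpos, hB', hA',
    hD', hL.eventually_ge_atTop 0, hL.eventually_ge_atTop (C.toReal / (1 / ρ - 1 / ρ'))]
    with v hv a b xB xA xD h0 hbig
  have e : ∀ t, L v * (t / ρ') = L v / ρ' * t := fun t => by ring
  simp only [e] at xB xA xD
  refine (hmain v hv (L v / ρ') (div_nonneg h0 p'.le) a b xB xA xD).trans ?_
  rw [← ENNReal.ofReal_toReal hC, ← ENNReal.ofReal_add (div_nonneg h0 p'.le)
    ENNReal.toReal_nonneg]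
  refine ENNReal.ofReal_le_ofReal ?_
  rw [div_le_iff₀ hk] at hbig
  calc L v / ρ' + C.toReal ≤ L v / ρ' + L v * (1 / ρ - 1 / ρ') := by linarith
    _ = L v / ρ := by ring

end Asymptotics

/-! ### Minimal information numbers and laws with one marginal replaced. -/

section Information

lemma exists_infoSet_eq {F : Type*} [MeasurableSpace F] (μ : Measure (ℕ → F))
    {𝒬 : Set (Measure (ℕ → F))} (hf : 𝒬.Finite) (hne : 𝒬.Nonempty) :
    ∃ ν ∈ 𝒬, info μ ν = infoSet μ 𝒬 :=
  (hne.image _).csInf_mem (hf.image _)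

variable {K : ℕ} {E : Fin K → Type*} [∀ i, MeasurableSpace (E i)] {M : Problem E}

lemma exists_minLocalInfo_eq {S : Finset (Fin K)} (hS : S.Nonempty) (P : Measure (Path E))
    {𝒬 : ∀ k : Fin K, Set (Measure (Traj E {k}))} (hf : ∀ k, (𝒬 k).Finite)
    (hne : ∀ k, (𝒬 k).Nonempty) :
    ∃ k ∈ S, ∃ ν ∈ 𝒬 k, info (marg {k} P) ν = Problem.minLocalInfo S P 𝒬 := by
  obtain ⟨k, hk, hk'⟩ := ((Finset.coe_nonempty.2 hS).image
    fun k => infoSet (marg {k} P) (𝒬 k)).csInf_mem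
    (S.finite_toSet.image _)
  obtain ⟨ν, hν, h⟩ := exists_infoSet_eq (marg {k} P) (hf k) (hne k)
  exact ⟨k, hk, ν, hν, h.trans hk'⟩

lemma minLocalInfo_le {S : Finset (Fin K)} {P : Measure (Path E)}
    {𝒬 : ∀ k : Fin K, Set (Measure (Traj E {k}))} (hf : ∀ k, (𝒬 k).Finite) {k : Fin K}
    (hk : k ∈ S) {ν : Measure (Traj E {k})} (hν : ν ∈ 𝒬 k) :
    Problem.minLocalInfo S P 𝒬 ≤ info (marg {k} P) ν :=
  (csInf_le (S.finite_toSet.image _).bddBelow ⟨k, hk, rfl⟩).trans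
    (csInf_le ((hf k).image _).bddBelow ⟨ν, hν, rfl⟩)

lemma exists_minGlobalInfo_eq {S : Finset (Fin K)} (hS : S.Nonempty) (P : Measure (Path E))
    {𝒬 : Fin K → Set (Measure (Path E))} (hf : ∀ k, (𝒬 k).Finite)
    (hne : ∀ k, (𝒬 k).Nonempty) :
    ∃ k ∈ S, ∃ Q ∈ 𝒬 k, info (marg Finset.univ P) (marg Finset.univ Q) =
      Problem.minGlobalInfo S P 𝒬 := by
  obtain ⟨k, hk, hk'⟩ := ((Finset.coe_nonempty.2 hS).image
    fun k => Problem.infoOn Finset.univ P (𝒬 k)).csInf_mem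
    (S.finite_toSet.image _)
  obtain ⟨_, ⟨Q, hQ, rfl⟩, h⟩ := exists_infoSet_eq (marg Finset.univ P)
    ((hf k).image (marg Finset.univ)) ((hne k).image _)
  exact ⟨k, hk, Q, hQ, h.trans hk'⟩

/-- The observations of `j` are a function of those of the sources other than `k`. -/
lemma marg_singleton_eq {P R : Measure (Path E)} {k j : Fin K} (hj : j ≠ k)
    (h : marg ({k}ᶜ : Finset (Fin K)) R = marg ({k}ᶜ : Finset (Fin K)) P) :
    marg {j} R = marg {j} P := by
  have hmem : ∀ i : ({j} : Finset (Fin K)), (i : Fin K) ∈ ({k}ᶜ : Finset (Fin K)) := by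
    rintro ⟨i, hi⟩
    rw [Finset.mem_singleton] at hi
    simp [hi, hj]
  let f : Traj E ({k}ᶜ : Finset (Fin K)) → Traj E {j} := fun y n i => y n ⟨i, hmem i⟩
  have hf : Measurable f := measurable_pi_lambda _ fun n => measurable_pi_lambda _ fun i =>
    (measurable_pi_apply _).comp (measurable_pi_apply n)
  have key : ∀ Q : Measure (Path E), marg {j} Q = (marg ({k}ᶜ : Finset (Fin K)) Q).map f :=
    fun Q => by
      rw [marg, marg, Measure.map_map hf (measurable_restr _)]
      rfl
  rw [key, key, h]

lemma Problem.mem_signals {P : Measure (Path E)} {k : Fin K} :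
    k ∈ M.signals P ↔ marg {k} P ∈ M.alt k := by
  simp [Problem.signals]

lemma Problem.null_finite (M : Problem E) (k : Fin K) : (M.null k).Finite :=
  (M.plaus_finite.image _).subset (M.null_subset k)

lemma Problem.alt_finite (M : Problem E) (k : Fin K) : (M.alt k).Finite :=
  (M.plaus_finite.image _).subset (M.alt_subset k)

lemma Problem.marg_mem_null {Q : Measure (Path E)} {k : Fin K} (hQ : Q ∈ M.nullAt k) :
    marg {k} Q ∈ M.null k :=
  (hQ.1.1.2.1 k).resolve_right fun h => hQ.2 (Problem.mem_signals.2 h)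

lemma Problem.marg_mem_alt {Q : Measure (Path E)} {k : Fin K} (hQ : Q ∈ M.altAt k) :
    marg {k} Q ∈ M.alt k :=
  Problem.mem_signals.1 hQ.2

lemma swap_marg_mem {P R : Measure (Path E)} {k : Fin K} {ν : Measure (Traj E {k})}
    (hP : P ∈ M.compat) (hν : ν ∈ M.null k ∪ M.alt k) (hR : IsSwap P k ν R) (j : Fin K) :
    marg {j} R ∈ M.null j ∪ M.alt j := by
  by_cases hj : j = k
  · subst hj; rw [hR.2.1]; exact hν
  · rw [marg_singleton_eq hj hR.2.2]; exact hP.2.1 j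

lemma swap_mem_signals {P R : Measure (Path E)} {k j : Fin K} {ν : Measure (Traj E {k})}
    (hR : IsSwap P k ν R) (hj : j ≠ k) : j ∈ M.signals R ↔ j ∈ M.signals P := by
  rw [Problem.mem_signals, Problem.mem_signals, marg_singleton_eq hj hR.2.2]

/-- The swap removes $k$ from the signals. The smaller set is still allowed by $\Psi_{0,u}$, and it
is non-empty because $P$ has a second signal, so the new law is no global null. -/
lemma swap_mem_nullAt {P R : Measure (Path E)} {k : Fin K} {ν : Measure (Traj E {k})} {u : ℕ}
    (hΨ : M.Ψ = psiBetween K 0 u) (hP : P ∈ M.compat) (hk : k ∈ M.signals P)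
    (hcard : 1 < (M.signals P).card) (hν : ν ∈ M.null k) (hRp : R ∈ M.plaus)
    (hR : IsSwap P k ν R) : R ∈ M.nullAt k := by
  have hkR : k ∉ M.signals R := fun h => by
    rw [Problem.mem_signals, hR.2.1] at h
    exact Set.disjoint_left.1 (M.disjoint k) hν h
  have hsig : M.signals R = (M.signals P).erase k := by
    ext j
    by_cases hj : j = k
    · subst hj; simp [hkR]
    · simp [hj, swap_mem_signals hR hj]
  have hPu : (M.signals P).card ≤ u := by
    have := hP.2.2
    rw [hΨ] at this
    exact this.2
  have hc := Finset.card_erase_of_mem hk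
  refine ⟨⟨⟨hRp, swap_marg_mem hP (Or.inl hν) hR, ?_⟩, fun h => ?_⟩, hkR⟩
  · rw [hΨ, hsig]
    exact ⟨zero_le, by omega⟩
  · have h0 := h.2.2
    rw [hsig] at h0
    rw [h0, Finset.card_empty] at hc
    omega

/-- The swap adds $k$ to the signals, for which $|\mathcal A(P)|<u$ leaves room. -/
lemma swap_mem_altAt {P R : Measure (Path E)} {k : Fin K} {ν : Measure (Traj E {k})} {u : ℕ}
    (hΨ : M.Ψ = psiBetween K 0 u) (hP : P ∈ M.compat)
    (hcard : (M.signals P).card < u) (hν : ν ∈ M.alt k) (hRp : R ∈ M.plaus)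
    (hR : IsSwap P k ν R) : R ∈ M.altAt k := by
  have hkR : k ∈ M.signals R := by
    rw [Problem.mem_signals, hR.2.1]
    exact hν
  have hsig : M.signals R = insert k (M.signals P) := by
    ext j
    by_cases hj : j = k
    · subst hj; simp [hkR]
    · simp [hj, swap_mem_signals hR hj]
  refine ⟨⟨hRp, swap_marg_mem hP (Or.inr hν) hR, ?_⟩, hkR⟩
  rw [hΨ, hsig]
  exact ⟨zero_le, (Finset.card_insert_le _ _).trans hcard⟩

end Information

end SeqMulti

namespace SeqMulti

/-! ### Lower bounds from the individual error constraints. -/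

section Rates

variable {l : Filter Levels} {K : ℕ} {E : Fin K → Type*} [∀ i, MeasurableSpace (E i)]
  {M : Problem E} {d : Problem.Design E} {P : Measure (Path E)}

/-- The error probability of `P` bounded by `|a| + |b|`, through two possible errors. -/
lemma measure_le_of_union {S A B : Set (Path E)} {a b : ℝ} (h : S ⊆ A ∪ B)
    (hA : P A ≤ ENNReal.ofReal a) (hB : P B ≤ ENNReal.ofReal b) :
    P S ≤ ENNReal.ofReal (|a| + |b|) := by
  refine (measure_mono h).trans ((measure_union_le _ _).trans ?_)
  rw [ENNReal.ofReal_add (abs_nonneg _) (abs_nonneg _)]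
  exact add_le_add (hA.trans (ENNReal.ofReal_le_ofReal (le_abs_self a)))
    (hB.trans (ENNReal.ofReal_le_ofReal (le_abs_self b)))

lemma tendsto_abs_add_abs {a b : Levels → ℝ} (ha : Tendsto a l (𝓝[>] 0))
    (hb : Tendsto b l (𝓝[>] 0)) : Tendsto (fun v => |a v| + |b v|) l (𝓝 0) := by
  have h := (tendsto_nhdsWithin_iff.1 ha).1.abs.add (tendsto_nhdsWithin_iff.1 hb).1.abs
  simpa using h

/-- Declaring $k$ is a false positive under `R`. Not declaring it is, under $P$, a missed detection
or a false negative, so it has vanishing probability. -/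
lemma eventually_le_optimal_nullAt (hl : l ≤ Levels.toZero) (hP : P ∈ M.compat \ M.globalNull)
    {k : Fin K} (hk : k ∈ M.signals P) {R : Measure (Path E)} (hR : R ∈ M.nullAt k)
    {Z : ℕ → Path E → ℝ} (hZ : IsLogLik P R Z) {c : ℝ} (hc0 : 0 < c)
    (hc : ∀ ρ : ℝ, c < ρ →
      Tendsto (fun n : ℕ => P {ω | ∃ m : ℕ, 1 ≤ m ∧ m ≤ n ∧ (n : ℝ) * ρ ≤ Z m ω}) atTop (𝓝 0))
    (ρ : ℝ) (hρ : c < ρ) :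
    ∀ᶠ v in l, ENNReal.ofReal (|Real.log v.γ| / ρ) ≤ M.optimal P v := by
  have := M.plaus_prob P hP.1.1
  obtain ⟨_, hβ, hγ, hδ⟩ := tendsto_levels hl
  refine eventually_le_optimal hZ hc0 hc (fun D => k ∈ D) (fun v T D h => ⟨?_, ?_⟩) hγ
    (tendsto_abs_add_abs hβ hδ) hρ
  · refine le_trans (measure_mono ?_) (h.2.2 R hR.1).2.1
    rintro ω ⟨ht, hD⟩
    exact ⟨ht, Finset.nonempty_iff_ne_empty.1 ⟨k, Finset.mem_sdiff.2 ⟨hD, hR.2⟩⟩⟩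
  · refine measure_le_of_union ?_ (h.2.2 P hP).1 (h.2.2 P hP).2.2
    rintro ω ⟨ht, hD⟩
    by_cases h0 : D ω = ∅
    · exact Or.inl ⟨ht, h0⟩
    · exact Or.inr ⟨ht, Finset.nonempty_iff_ne_empty.1 ⟨k, Finset.mem_sdiff.2 ⟨hk, hD⟩⟩, h0⟩

/-- Omitting $k$ is a false negative under `R` only when $D\ne\emptyset$, whence the extra clause in
the event. Its negation is, under $P$, a missed detection or a false positive. -/
lemma eventually_le_optimal_altAt (hl : l ≤ Levels.toZero) (hP : P ∈ M.compat \ M.globalNull)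
    {k : Fin K} (hk : k ∉ M.signals P) {R : Measure (Path E)} (hR : R ∈ M.altAt k)
    {Z : ℕ → Path E → ℝ} (hZ : IsLogLik P R Z) {c : ℝ} (hc0 : 0 < c)
    (hc : ∀ ρ : ℝ, c < ρ →
      Tendsto (fun n : ℕ => P {ω | ∃ m : ℕ, 1 ≤ m ∧ m ≤ n ∧ (n : ℝ) * ρ ≤ Z m ω}) atTop (𝓝 0))
    (ρ : ℝ) (hρ : c < ρ) :
    ∀ᶠ v in l, ENNReal.ofReal (|Real.log v.δ| / ρ) ≤ M.optimal P v := by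
  have := M.plaus_prob P hP.1.1
  obtain ⟨_, hβ, hγ, hδ⟩ := tendsto_levels hl
  have hR0 : R ∈ M.compat \ M.globalNull := ⟨hR.1, fun h => by
    have h' := hR.2
    rw [h.2.2] at h'
    exact Finset.notMem_empty k h'⟩
  refine eventually_le_optimal hZ hc0 hc (fun D => k ∉ D ∧ D ≠ ∅) (fun v T D h => ⟨?_, ?_⟩) hδ
    (tendsto_abs_add_abs hβ hγ) hρ
  · refine le_trans (measure_mono ?_) (h.2.2 R hR0).2.2
    rintro ω ⟨ht, hD, h0⟩
    exact ⟨ht, Finset.nonempty_iff_ne_empty.1 ⟨k, Finset.mem_sdiff.2 ⟨hR.2, hD⟩⟩, h0⟩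
  · refine measure_le_of_union ?_ (h.2.2 P hP).1 (h.2.2 P hP).2.1
    rintro ω ⟨ht, hD⟩
    by_cases h0 : D ω = ∅
    · exact Or.inl ⟨ht, h0⟩
    · refine Or.inr ⟨ht, Finset.nonempty_iff_ne_empty.1 ⟨k, Finset.mem_sdiff.2 ⟨?_, hk⟩⟩⟩
      by_contra hkD
      exact hD ⟨hkD, h0⟩

lemma exists_pos_forall_lt_info {p : Fin K → Prop} {𝒬 : Fin K → Set (Measure (Path E))}
    (hf : ∀ k, (𝒬 k).Finite) (h : ∀ k, p k → ∀ Q ∈ 𝒬 k, 0 < info (marg {k} P) (marg {k} Q)) :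
    ∃ ρ : ℝ, 0 < ρ ∧ ∀ k, p k → ∀ Q ∈ 𝒬 k, ρ < info (marg {k} P) (marg {k} Q) := by
  have hfin : {x : Fin K × Measure (Path E) | p x.1 ∧ x.2 ∈ 𝒬 x.1}.Finite := by
    refine (Set.finite_univ.prod (Set.finite_iUnion hf)).subset ?_
    rintro ⟨k, Q⟩ ⟨_, hQ⟩
    exact ⟨trivial, Set.mem_iUnion.2 ⟨k, hQ⟩⟩
  obtain ⟨ρ, h0, hρ⟩ := exists_pos_forall_lt hfin
    (f := fun x => info (marg {x.1} P) (marg {x.1} x.2)) fun x hx => h x.1 hx.1 x.2 hx.2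
  exact ⟨ρ, h0, fun k hk Q hQ => hρ (k, Q) ⟨hk, hQ⟩⟩

end Rates

end SeqMulti

/-! ### The theorem. -/

open SeqMulti
theorem mainTheorem10 {K : ℕ} {E : Fin K → Type*} [∀ i, MeasurableSpace (E i)]
    (M : Problem E) (d : Problem.Design E)
    (h_nullAt : ∀ k, (M.nullAt k).Nonempty) (h_altAt : ∀ k, (M.altAt k).Nonempty)
    (h_ac : M.AbsContAssumption) (h_info : M.InfoAssumption)
    (h_adm : M.Admissible d) (h_iso : ∀ k, d.isoSub k = {k})
    (h_empty : ∅ ∈ M.Ψ)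
    (P : Measure (Path E)) (hP : P ∈ M.compat \ M.globalNull)
    (l : Filter Levels) [l.NeBot] (hl : l ≤ Levels.toZero) :
    -- (i) the level of false positives is the dominant one
    ((fun v : Levels => max |Real.log v.α| |Real.log v.δ|) =o[l] (fun v => |Real.log v.γ|) →
      (∀ k ∈ M.signals P, ∀ ν ∈ M.null k, InfoDefined (marg {k} P) ν) →
        M.ARE d P l ≤ ENNReal.ofReal
          (Problem.minGlobalInfo (M.signals P) P M.nullAt /
            Problem.minLocalInfo (M.signals P) P M.null) ∧
        (∀ u : ℕ, M.Ψ = psiBetween K 0 u → 1 < (M.signals P).card →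
          (∃ k, M.IndepHardest (M.signals P) P M.null k) → M.ARE d P l = 1)) ∧
    -- (ii) the level of false negatives is the dominant one
    ((fun v : Levels => max |Real.log v.α| |Real.log v.γ|) =o[l] (fun v => |Real.log v.δ|) →
      (M.signals P)ᶜ.Nonempty →
      (∀ k ∈ (M.signals P)ᶜ, ∀ ν ∈ M.alt k, InfoDefined (marg {k} P) ν) →
        M.ARE d P l ≤ ENNReal.ofReal
          (Problem.minGlobalInfo (M.signals P)ᶜ P M.altAt /
            Problem.minLocalInfo (M.signals P)ᶜ P M.alt) ∧
        (∀ u : ℕ, M.Ψ = psiBetween K 0 u → (M.signals P).card < u →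
          (∃ k, M.IndepHardest (M.signals P)ᶜ P M.alt k) → M.ARE d P l = 1)) := by
  have hPp : IsProbabilityMeasure P := M.plaus_prob P hP.1.1
  have hne : (M.signals P).Nonempty := Finset.nonempty_iff_ne_empty.2 fun h =>
    hP.2 ⟨hP.1.1, hP.1.2.1, h⟩
  obtain ⟨k₀, hk₀⟩ := hne
  obtain ⟨_, _, hγ, hδ⟩ := tendsto_levels hl
  have hself : ∀ k : Fin K, k ∈ ({k} : Finset (Fin K)) := Finset.mem_singleton_self
  have hPalt : ∀ k ∈ M.signals P, P ∈ M.altAt k := fun k hk => ⟨hP.1, hk⟩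
  have hPnull : ∀ k ∉ M.signals P, P ∈ M.nullAt k := fun k hk => ⟨hP, hk⟩
  constructor
  · intro ho hdef
    set L : Levels → ℝ := fun v => |Real.log v.γ| with hLdef
    have hL : Tendsto L l atTop := tendsto_abs_log hγ
    obtain ⟨hoα, hoδ⟩ := isLittleO_of_max ho
    set ρ₀ := Problem.minLocalInfo (M.signals P) P M.null with hρ₀def
    have hρ₀ : 0 < ρ₀ := by
      obtain ⟨k, hk, ν, hν, h⟩ :=
        exists_minLocalInfo_eq ⟨k₀, hk₀⟩ P M.null_finite M.null_nonempty
      rw [hρ₀def, ← h]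
      exact (isInfo_info (hdef k hk ν hν).2).1
    -- The thresholds $A_k$ have logarithms $o(|\log\gamma|)$, so any positive rate suffices for the
    -- sources that are no signals.
    obtain ⟨ρ₂, h₂, hρ₂⟩ := exists_pos_forall_lt_info (p := fun k => k ∉ M.signals P)
      (P := P) M.altAt_finite fun k hk Q hQ =>
        (isInfo_info (h_info k Q hQ P (Or.inl (hPnull k hk)) _ (hself k)).2).1
    have hup : ∀ ρ, 0 < ρ → ρ < ρ₀ →
        ∀ᶠ v in l, Problem.expect P (M.stopStar d v) ≤ ENNReal.ofReal (L v / ρ) := by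
      intro ρ hρ hlt
      -- Of $\rho<\rho'<\rho_1<\rho_0$, the factor $\rho_1/\rho'>1$ absorbs the error in $\log
      -- B_k\sim|\log\gamma|$.
      obtain ⟨ρ₁, h1, h1'⟩ := exists_between hlt
      obtain ⟨ρ', h2, h2'⟩ := exists_between h1
      have p' : 0 < ρ' := hρ.trans h2
      exact eventually_expect_stopStar_le h_nullAt h_altAt h_ac h_info h_adm h_iso hP hk₀
        (fun k hk Q hQ => h1'.trans_le
          (minLocalInfo_le M.null_finite hk (Problem.marg_mem_null hQ)))
        hρ₂ (p'.trans h2') h₂ hl hL hρ h2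
        (fun k _ => eventually_le_mul_of_isEquivalent ((h_adm.log_B k).mono hl) hL
          ((one_lt_div p').2 h2'))
        (fun k _ => eventually_le_mul_of_isLittleO
          (((h_adm.log_A k).mono hl).isBigO.trans_isLittleO hoδ) hL (div_pos h₂ p'))
        hoα
    refine ⟨?_, ?_⟩
    · obtain ⟨k, hk, Q, hQ, h⟩ :=
        exists_minGlobalInfo_eq ⟨k₀, hk₀⟩ P M.nullAt_finite h_nullAt
      have hQp := M.plaus_prob Q hQ.1.1.1
      have hI := isInfo_info
        (h_info k P (hPalt k hk) Q (Or.inl hQ) Finset.univ (Finset.mem_univ k)).1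
      rw [← h]
      exact ARE_le hL hI.1 hρ₀ hup (eventually_le_optimal_nullAt hl hP hk hQ
        (isLogLik_marg_univ (h_ac k P (Or.inl (hPalt k hk)) Q (Or.inl hQ) _ (Finset.mem_univ k)))
        hI.1 (tendsto_info_excess hI))
    · rintro u hΨ hcard ⟨k, hk, hind, hmin, ν, hν, hν', R, hRp, hR⟩
      have := M.plaus_prob R hRp
      have hI := isInfo_info (hdef k hk ν hν).2
      -- The lower bound now has the constant $\rho_0$ of the upper bound, so the quotient is $1$.
      rw [hν', hmin] at hI
      refine le_antisymm ?_ (one_le_ARE hl h_adm ?_)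
      · have := ARE_le hL hI.1 hρ₀ hup (eventually_le_optimal_nullAt hl hP hk
          (swap_mem_nullAt hΨ hP.1 hk hcard hν hRp hR)
          (isLogLik_swap hind hR (hdef k hk ν hν).1) hI.1 (tendsto_info_excess hI))
        rwa [div_self hρ₀.ne', ENNReal.ofReal_one] at this
      · exact (hup (ρ₀ / 2) (half_pos hρ₀) (half_lt_self hρ₀)).mono fun v hv =>
          ne_top_of_le_ne_top ENNReal.ofReal_ne_top hv
  · intro ho hnc hdef
    set L : Levels → ℝ := fun v => |Real.log v.δ| with hLdef
    have hL : Tendsto L l atTop := tendsto_abs_log hδ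
    obtain ⟨hoα, hoγ⟩ := isLittleO_of_max ho
    set ρ₀ := Problem.minLocalInfo (M.signals P)ᶜ P M.alt with hρ₀def
    have hρ₀ : 0 < ρ₀ := by
      obtain ⟨k, hk, ν, hν, h⟩ := exists_minLocalInfo_eq hnc P M.alt_finite M.alt_nonempty
      rw [hρ₀def, ← h]
      exact (isInfo_info (hdef k hk ν hν).2).1
    obtain ⟨ρ₁, h₁, hρ₁⟩ := exists_pos_forall_lt_info (p := fun k => k ∈ M.signals P)
      (P := P) M.nullAt_finite fun k hk Q hQ =>
        (isInfo_info (h_info k P (hPalt k hk) Q (Or.inl hQ) _ (hself k)).1).1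
    have hup : ∀ ρ, 0 < ρ → ρ < ρ₀ →
        ∀ᶠ v in l, Problem.expect P (M.stopStar d v) ≤ ENNReal.ofReal (L v / ρ) := by
      intro ρ hρ hlt
      obtain ⟨ρ₂, h1, h1'⟩ := exists_between hlt
      obtain ⟨ρ', h2, h2'⟩ := exists_between h1
      have p' : 0 < ρ' := hρ.trans h2
      exact eventually_expect_stopStar_le h_nullAt h_altAt h_ac h_info h_adm h_iso hP hk₀ hρ₁
        (fun k hk Q hQ => h1'.trans_le
          (minLocalInfo_le M.alt_finite (Finset.mem_compl.2 hk) (Problem.marg_mem_alt hQ)))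
        h₁ (p'.trans h2') hl hL hρ h2
        (fun k _ => eventually_le_mul_of_isLittleO
          (((h_adm.log_B k).mono hl).isBigO.trans_isLittleO hoγ) hL (div_pos h₁ p'))
        (fun k _ => eventually_le_mul_of_isEquivalent ((h_adm.log_A k).mono hl) hL
          ((one_lt_div p').2 h2'))
        hoα
    refine ⟨?_, ?_⟩
    · obtain ⟨k, hk, Q, hQ, h⟩ := exists_minGlobalInfo_eq hnc P M.altAt_finite h_altAt
      rw [Finset.mem_compl] at hk
      have hQp := M.plaus_prob Q hQ.1.1
      -- Here $P$ plays the null for $k$, so the second of the two assumed information numbers is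
      -- the relevant one.
      have hI := isInfo_info
        (h_info k Q hQ P (Or.inl (hPnull k hk)) Finset.univ (Finset.mem_univ k)).2
      rw [← h]
      exact ARE_le hL hI.1 hρ₀ hup (eventually_le_optimal_altAt hl hP hk hQ
        (isLogLik_marg_univ
          (h_ac k Q (Or.inl hQ) P (Or.inl (hPnull k hk)) _ (Finset.mem_univ k)).symm)
        hI.1 (tendsto_info_excess hI))
    · rintro u hΨ hcard ⟨k, hk, hind, hmin, ν, hν, hν', R, hRp, hR⟩
      have := M.plaus_prob R hRp
      have hI := isInfo_info (hdef k hk ν hν).2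
      rw [hν', hmin] at hI
      refine le_antisymm ?_ (one_le_ARE hl h_adm ?_)
      · have := ARE_le hL hI.1 hρ₀ hup (eventually_le_optimal_altAt hl hP (Finset.mem_compl.1 hk)
          (swap_mem_altAt hΨ hP.1 hcard hν hRp hR)
          (isLogLik_swap hind hR (hdef k hk ν hν).1) hI.1 (tendsto_info_excess hI))
        rwa [div_self hρ₀.ne', ENNReal.ofReal_one] at this
      · exact (hup (ρ₀ / 2) (half_pos hρ₀) (half_lt_self hρ₀)).mono fun v hv =>
          ne_top_of_le_ne_top ENNReal.ofReal_ne_top hv
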